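/- All manifolds and structures are smooth ($C^\infty$); $M$ is an $n$-dimensional manifold (Hausdorff, second countable). A Dirac structure on $M$ is a rank $n$ subbundle $L\subset TM\oplus T^*M$ that is isotropic for $\langle (X_1,\alpha_1),(X_2,\alpha_2)\rangle=\frac12(\alpha_1(X_2)+\alpha_2(X_1))$ and closed under the Courant bracket $[(X_1,\alpha_1),(X_2,\alpha_2)]=([X_1,X_2],\mathcal L_{X_1}\alpha_2-i_{X_2}d\alpha_1)$. Its pre-symplectic leaves are the leaves of the singular distribution $\mathrm{pr}_{TM}(L)$, i.e. the classes of points that can be joined by concatenations of integral curves of the vector field components of local sections of $L$; the tangent space of a leaf at $x$ is $\mathrm{pr}_{TM}(L_x)$. A leaf $S$ is singular if every neighborhood of $S$ meets a leaf of higher dimension. For $s\ge 0$, the $C^s$-topology on bivector fields is that of uniform convergence on compact sets of the derivatives of order $\le s$; the $C^s$-topology on Dirac structures is the one defined in the same way by means of local frames, regarded as local sections of $TM\oplus T^*M$. A leaf $S$ of $(M,L)$ is stable for the $C^s$-topology if for every neighborhood $U$ of $S$ there is a $C^s$-neighborhood $\mathcal W$ of $L$ such that every Dirac structure $L'\in\mathcal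 W$ has a pre-symplectic leaf $S'$ with $\dim S'=\dim S$ and $S'\cap U\neq\emptyset$. Let $k\geq 1$. A singularity of order $k$ of a bivector field $\pi$ is a point at which the $(k-1)$-jet of $\pi$ vanishes but the $k$-jet does not. A singularity $m$ of order $k$ of a Poisson structure $\pi$ on a manifold $N$ is $k$-stable if for every neighborhood $\Omega$ of $m$ there is a $C^{2k}$-neighborhood of $\pi$ in the space of bivector fields on $N$ in which every Poisson structure has a singularity of order $k$ in $\Omega$. If $S$ is a leaf of $(M,L)$, $m_0\in S$, and $N\subset M$ is a (sufficiently small) embedded submanifold through $m_0$ with $T_{m_0}M=T_{m_0}S\oplus T_{m_0}N$, then $\{(X,\xi|_{TN}) : X\in TN,\ (X,\xi)\in L\}$ is the graph of a Poisson structure on $N$ vanishing at $m_0$; its germ at $m_0$ is the transverse Poisson structure. The point $m_0$ is called a $k$-stable singular point for the transverse Poisson structure if, for such an $N$, $m_0$ is a $k$-stable singularity of the restriction of this Poisson structure to every open neighborhood of $m_0$ in $N$. **Proposition 4.1.** Let $S$ be an embedded singular pre-symplectic leaf of a Dirac manifold $(M,L)$, and suppose that $m_0\in S$ is a $k$-stable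 singular point for the transverse Poisson structure. Then $S$ is stable for the $C^{2k}$-topology. -/

import Mathlib

open scoped Manifold ContDiff Topology

noncomputable section

namespace DiracStability

/-! ### Local calculus on a normed space `F`; the dual is `F →L[ℝ] ℝ`. -/

section LocalCalculus

variable {F : Type*} [NormedAddCommGroup F] [NormedSpace ℝ F]

/-- The Lie derivative `ℒ_X β` of a 1-form along a vector field:
`(ℒ_X β)(v) = (Dβ[X])(v) + β(DX[v])`. -/
def lieDerivForm (X : F → F) (β : F → (F →L[ℝ] ℝ)) (x : F) : F →L[ℝ] ℝ :=
  fderiv ℝ β x (X x) + (β x).comp (fderiv ℝ X x)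

/-- The contraction `i_Y dα`, where `dα(u, v) = (Dα[u])(v) - (Dα[v])(u)`. -/
def contractExtDeriv (Y : F → F) (α : F → (F →L[ℝ] ℝ)) (x : F) : F →L[ℝ] ℝ :=
  fderiv ℝ α x (Y x) - (fderiv ℝ α x).flip (Y x)

/-- The Courant bracket
`[(X₁, α₁), (X₂, α₂)] = ([X₁, X₂], ℒ_{X₁} α₂ - i_{X₂} dα₁)`
of sections of `TF ⊕ T*F`. -/
def courantBracket (s t : F → F × (F →L[ℝ] ℝ)) (x : F) : F × (F →L[ℝ] ℝ) :=
  (VectorField.lieBracket ℝ (fun y => (s y).1) (fun y => (t y).1) x,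
    lieDerivForm (fun y => (s y).1) (fun y => (t y).2) x
      - contractExtDeriv (fun y => (t y).1) (fun y => (s y).2) x)

/-- `e` is a smooth frame over the open set `V` of the field of subspaces `L` of `TF ⊕ T*F`
(when the fibres of `L` have dimension `r`). -/
structure IsSmoothFrameOn {r : ℕ} (L : F → Submodule ℝ (F × (F →L[ℝ] ℝ))) (V : Set F)
    (e : Fin r → F → F × (F →L[ℝ] ℝ)) : Prop where
  smooth : ∀ i, ContDiffOn ℝ ∞ (e i) V
  span_eq : ∀ y ∈ V, Submodule.span ℝ (Set.range fun i => e i y) = L y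

/-- `L` is a Dirac structure over the open set `U`: a smooth subbundle of `TU ⊕ T*U`,
of rank `dim F`, isotropic, and closed under the Courant bracket of local sections. -/
structure IsDiracOn (U : Set F) (L : F → Submodule ℝ (F × (F →L[ℝ] ℝ))) : Prop where
  rank : ∀ x ∈ U, Module.finrank ℝ (L x) = Module.finrank ℝ F
  smooth : ∀ x ∈ U, ∃ V : Set F, IsOpen V ∧ x ∈ V ∧ V ⊆ U ∧
    ∃ e : Fin (Module.finrank ℝ F) → F → F × (F →L[ℝ] ℝ), IsSmoothFrameOn L V e
  isotropic : ∀ x ∈ U, ∀ u ∈ L x, ∀ v ∈ L x, (1 / 2 : ℝ) * (u.2 v.1 + v.2 u.1) = 0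
  involutive : ∀ V : Set F, IsOpen V → V ⊆ U → ∀ s t : F → F × (F →L[ℝ] ℝ),
    ContDiffOn ℝ ∞ s V → ContDiffOn ℝ ∞ t V → (∀ y ∈ V, s y ∈ L y) → (∀ y ∈ V, t y ∈ L y) →
    ∀ y ∈ V, courantBracket s t y ∈ L y

/-! ### Bivector fields, Poisson structures and their `k`-stable singularities.

A bivector at a point is a skew map `π♯ : T* → T`, the bilinear form being
`π(α, β) = β (π♯ α)`. -/

/-- Smooth bivector fields on the open set `V` of `F`
(the values of the function outside `V` are irrelevant). -/
structure BivectorField (V : Set F) where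
  toFun : F → ((F →L[ℝ] ℝ) →L[ℝ] F)
  smooth : ContDiffOn ℝ ∞ toFun V
  skew : ∀ x ∈ V, ∀ α β : F →L[ℝ] ℝ, β (toFun x α) = -α (toFun x β)

/-- Restriction of a bivector field to a smaller open set. -/
def BivectorField.restrict {V V' : Set F} (π : BivectorField V) (h : V' ⊆ V) :
    BivectorField V' where
  toFun := π.toFun
  smooth := π.smooth.mono h
  skew x hx := π.skew x (h hx)

/-- The `C^s`-topology on bivector fields on `V`: uniform convergence on the compact subsets
of `V` of the derivatives of order `0, …, s`. -/
@[reducible] def BivectorField.csTopology (s : ℕ) (V : Set F) : TopologicalSpace (BivectorField V) :=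
  TopologicalSpace.induced
    (fun (π : BivectorField V) (j : Fin (s + 1)) =>
      UniformOnFun.ofFun {K : Set F | IsCompact K ∧ K ⊆ V} (iteratedFDeriv ℝ (j : ℕ) π.toFun))
    inferInstance

/-- `π` is a Poisson structure on `V`: `[π, π] = 0`. In coordinates the components of
`½ [π, π]` are the cyclic sums `∑ₗ (π^{il} ∂ₗ π^{jm} + cyclic)`, that is, the cyclic sum of
`(Dπ(x)[π♯ α])(β, γ)`, here for all constant covectors `α`, `β`, `γ`. -/
def BivectorField.IsPoisson {V : Set F} (π : BivectorField V) : Prop :=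
  ∀ x ∈ V, ∀ α β γ : F →L[ℝ] ℝ,
    γ (fderiv ℝ π.toFun x (π.toFun x α) β) + α (fderiv ℝ π.toFun x (π.toFun x β) γ)
      + β (fderiv ℝ π.toFun x (π.toFun x γ) α) = 0

/-- The point `x` is a singularity of order `k > 0` of `π`: the `(k-1)`-jet of `π` vanishes
at `x`, but not the `k`-jet. -/
def BivectorField.IsSingularityOfOrder {V : Set F} (π : BivectorField V) (k : ℕ) (x : F) : Prop :=
  0 < k ∧ x ∈ V ∧ (∀ j < k, iteratedFDeriv ℝ j π.toFun x = 0) ∧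
    iteratedFDeriv ℝ k π.toFun x ≠ 0

/-- The singularity `m` of order `k` of the Poisson structure `π` on the open set `V` is
`k`-stable with respect to the `C^s`-topology on bivector fields on `V`. -/
def BivectorField.IsKStable {V : Set F} (π : BivectorField V) (s k : ℕ) (m : F) : Prop :=
  π.IsPoisson ∧ π.IsSingularityOfOrder k m ∧
    ∀ Ω ∈ 𝓝 m, ∃ W ∈ @nhds _ (BivectorField.csTopology s V) π,
      ∀ π' ∈ W, π'.IsPoisson → ∃ x ∈ Ω, π'.IsSingularityOfOrder k x

/-- The graph `{(π♯ α, α)}` of a bivector. -/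
def graph (p : (F →L[ℝ] ℝ) →L[ℝ] F) : Set (F × (F →L[ℝ] ℝ)) :=
  {u | u.1 = p u.2}

end LocalCalculus

/-! ### Dirac manifolds -/

section Manifolds

variable {n : ℕ} {M : Type*} [TopologicalSpace M] [ChartedSpace (EuclideanSpace ℝ (Fin n)) M]

/-- The backward image (pull-back) of a field `L` of subspaces of `TM ⊕ T*M` under a map
`f : F → M`: its fibre at `y` is `{(v, ξ ∘ df_y) : (df_y v, ξ) ∈ L (f y)}`. -/
def backwardImage {F : Type*} [NormedAddCommGroup F] [NormedSpace ℝ F]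
    (L : (x : M) → Submodule ℝ (TangentSpace (𝓡 n) x × (TangentSpace (𝓡 n) x →L[ℝ] ℝ)))
    (f : F → M) (y : F) : Submodule ℝ (F × (F →L[ℝ] ℝ)) where
  carrier := {p | ∃ ξ : TangentSpace (𝓡 n) (f y) →L[ℝ] ℝ,
    (mfderiv 𝓘(ℝ, F) (𝓡 n) f y p.1, ξ) ∈ L (f y) ∧
      p.2 = ξ.comp (mfderiv 𝓘(ℝ, F) (𝓡 n) f y)}
  zero_mem' := by
    refine ⟨0, ?_, ?_⟩
    · have h := (L (f y)).zero_mem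
      convert h using 1
      ext1
      · exact map_zero (mfderiv 𝓘(ℝ, F) (𝓡 n) f y)
      · rfl
    · exact (ContinuousLinearMap.zero_comp _).symm
  add_mem' := by
    rintro p q ⟨ξ, hξ, hp⟩ ⟨η, hη, hq⟩
    refine ⟨ξ + η, ?_, ?_⟩
    · have h := (L (f y)).add_mem hξ hη
      convert h using 1
      ext1
      · exact map_add (mfderiv 𝓘(ℝ, F) (𝓡 n) f y) p.1 q.1
      · rfl
    · change p.2 + q.2 = _
      rw [hp, hq]
      exact (ContinuousLinearMap.add_comp _ _ _).symm
  smul_mem' := by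
    rintro c p ⟨ξ, hξ, hp⟩
    refine ⟨c • ξ, ?_, ?_⟩
    · have h := (L (f y)).smul_mem c hξ
      convert h using 1
      ext1
      · exact map_smul (mfderiv 𝓘(ℝ, F) (𝓡 n) f y) c p.1
      · rfl
    · change c • p.2 = _
      rw [hp]
      exact (ContinuousLinearMap.smul_comp _ _ _).symm

/-- The expression in a chart `φ` of a field `L` of subspaces of `TM ⊕ T*M`
(meaningful on `φ.target`). -/
def inChart
    (L : (x : M) → Submodule ℝ (TangentSpace (𝓡 n) x × (TangentSpace (𝓡 n) x →L[ℝ] ℝ)))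
    (φ : OpenPartialHomeomorph M (EuclideanSpace ℝ (Fin n))) :
    EuclideanSpace ℝ (Fin n) →
      Submodule ℝ (EuclideanSpace ℝ (Fin n) × (EuclideanSpace ℝ (Fin n) →L[ℝ] ℝ)) :=
  backwardImage L φ.symm

variable (n M) in
/-- Dirac structures on the `n`-dimensional manifold `M`: fields of subspaces of `TM ⊕ T*M`
which are Dirac structures in every chart of the smooth structure. -/
structure DiracStructure where
  fiber : (x : M) → Submodule ℝ (TangentSpace (𝓡 n) x × (TangentSpace (𝓡 n) x →L[ℝ] ℝ))
  isDirac : ∀ φ ∈ IsManifold.maximalAtlas (𝓡 n) ∞ M, IsDiracOn φ.target (inChart fiber φ)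

variable (n) in
/-- `S` is an embedded submanifold of `M`: for some `d`, it is a `d`-dimensional slice in a
chart of `M` around each of its points. -/
def IsEmbeddedSubmanifold (S : Set M) : Prop :=
  ∃ d : ℕ, ∀ p ∈ S, ∃ φ ∈ IsManifold.maximalAtlas (𝓡 n) ∞ M, p ∈ φ.source ∧
    ∃ P : Submodule ℝ (EuclideanSpace ℝ (Fin n)), Module.finrank ℝ P = d ∧
      ∀ q ∈ φ.source, q ∈ S ↔ φ q ∈ P

namespace DiracStructure

/-- The `C^s`-topology on Dirac structures. A subbasic open set is given by a chart `φ`,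
a compact set `K` inside an open set `V` of the chart domain, smooth local sections
`e₁, …, eₙ` of `TM ⊕ T*M` over `V` (in the chart) and `ε > 0`. It consists of the Dirac
structures which have, on a neighbourhood of `K`, a smooth frame `e'₁, …, e'ₙ` whose
derivatives of order `≤ s` are uniformly `ε`-close on `K` to those of `e₁, …, eₙ`. -/
@[reducible] def csTopology (s : ℕ) : TopologicalSpace (DiracStructure n M) :=
  TopologicalSpace.generateFrom
    {W | ∃ φ ∈ IsManifold.maximalAtlas (𝓡 n) ∞ M, ∃ V K : Set (EuclideanSpace ℝ (Fin n)),
      ∃ e : Fin n → EuclideanSpace ℝ (Fin n) →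
        EuclideanSpace ℝ (Fin n) × (EuclideanSpace ℝ (Fin n) →L[ℝ] ℝ), ∃ ε : ℝ,
      IsOpen V ∧ V ⊆ φ.target ∧ IsCompact K ∧ K ⊆ V ∧ (∀ i, ContDiffOn ℝ ∞ (e i) V) ∧ 0 < ε ∧
      W = {L' : DiracStructure n M |
        ∃ V' : Set (EuclideanSpace ℝ (Fin n)), IsOpen V' ∧ V' ⊆ V ∧ K ⊆ V' ∧
        ∃ e' : Fin n → EuclideanSpace ℝ (Fin n) →
          EuclideanSpace ℝ (Fin n) × (EuclideanSpace ℝ (Fin n) →L[ℝ] ℝ),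
          IsSmoothFrameOn (inChart L'.fiber φ) V' e' ∧
          ∀ i, ∀ j ≤ s, ∀ x ∈ K, ‖iteratedFDeriv ℝ j (e' i) x - iteratedFDeriv ℝ j (e i) x‖ < ε}}

variable (L : DiracStructure n M)

/-- The characteristic distribution: the projection of `L` to `TM` at the point `x`. -/
def charDist (x : M) : Submodule ℝ (TangentSpace (𝓡 n) x) :=
  (L.fiber x).map (LinearMap.fst ℝ _ _)

/-- `x` and `y` are the ends of an integral curve, defined on `[0, 1]`, of the vector field
component `X` of a smooth local section `(X, α)` of `L` (everything being read in a chart). -/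
def Joined (x y : M) : Prop :=
  ∃ φ ∈ IsManifold.maximalAtlas (𝓡 n) ∞ M, ∃ V : Set (EuclideanSpace ℝ (Fin n)),
    IsOpen V ∧ V ⊆ φ.target ∧
    ∃ s : EuclideanSpace ℝ (Fin n) →
        EuclideanSpace ℝ (Fin n) × (EuclideanSpace ℝ (Fin n) →L[ℝ] ℝ),
      ContDiffOn ℝ ∞ s V ∧ (∀ z ∈ V, s z ∈ inChart L.fiber φ z) ∧
      ∃ γ : ℝ → EuclideanSpace ℝ (Fin n),
        (∀ t ∈ Set.Icc (0 : ℝ) 1,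
          γ t ∈ V ∧ HasDerivWithinAt γ (s (γ t)).1 (Set.Icc (0 : ℝ) 1) t) ∧
        φ.symm (γ 0) = x ∧ φ.symm (γ 1) = y

/-- The pre-symplectic leaves of `L`: the leaves (in the sense of Stefan and Sussmann) of the
characteristic distribution, that is, the classes of the equivalence relation generated by
moving along integral curves of local sections of `L`. -/
def IsLeaf (S : Set M) : Prop :=
  ∃ m : M, S = {x | Relation.EqvGen L.Joined m x}

/-- The leaf `S` has dimension `d`. The tangent space of a leaf at each of its points is the
characteristic distribution there. -/
def HasLeafDim (S : Set M) (d : ℕ) : Prop :=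
  ∀ m ∈ S, Module.finrank ℝ (L.charDist m) = d

/-- The leaf `S` is singular: every neighbourhood of `S` meets a leaf of higher dimension. -/
def IsSingularLeaf (S : Set M) : Prop :=
  L.IsLeaf S ∧ ∀ U : Set M, IsOpen U → S ⊆ U →
    ∃ S' : Set M, L.IsLeaf S' ∧ (S' ∩ U).Nonempty ∧
      ∀ p ∈ S, ∀ q ∈ S', Module.finrank ℝ (L.charDist p) < Module.finrank ℝ (L.charDist q)

/-- The leaf `S` is stable with respect to the `C^s`-topology: for every neighbourhood `U` of
`S`, all Dirac structures in a neighbourhood of `L` have a leaf that meets `U` and has the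
same dimension as `S`. -/
def IsStableLeaf (s : ℕ) (S : Set M) : Prop :=
  ∃ d : ℕ, L.HasLeafDim S d ∧
    ∀ U : Set M, IsOpen U → S ⊆ U → ∃ W ∈ @nhds _ (csTopology s) L, ∀ L' ∈ W,
      ∃ S' : Set M, L'.IsLeaf S' ∧ L'.HasLeafDim S' d ∧ (S' ∩ U).Nonempty

/-- `π` is the transverse Poisson structure of `L` at `m₀`, on an embedded submanifold `N`
through `m₀` with `T_{m₀} M = T_{m₀} S ⊕ T_{m₀} N` for the leaf `S` of `m₀`. Here `N` is the
image of the embedding `j` of the open set `V` of `ℝʳ` (`j⁻¹` is a chart of `N` centred at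
`m₀`), and the graph of `π` is the Dirac structure which `L` induces on `N`. -/
structure IsTransversePoisson {r : ℕ} (m₀ : M) (V : Set (EuclideanSpace ℝ (Fin r)))
    (j : EuclideanSpace ℝ (Fin r) → M) (π : BivectorField V) : Prop where
  isOpen : IsOpen V
  zero_mem : 0 ∈ V
  map_zero : j 0 = m₀
  smooth : ContMDiffOn (𝓡 r) (𝓡 n) ∞ j V
  immersion : ∀ y ∈ V, Function.Injective (mfderiv (𝓡 r) (𝓡 n) j y)
  embedding : Topology.IsEmbedding (V.domRestrict j)
  transverse : IsCompl (L.charDist (j 0)) (LinearMap.range (mfderiv (𝓡 r) (𝓡 n) j 0).toLinearMap)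
  isPoisson : π.IsPoisson
  induced : ∀ y ∈ V, (backwardImage L.fiber j y : Set _) = graph (π.toFun y)

/-- `m₀` is a `k`-stable singular point of the transverse Poisson structure of `L` at `m₀`,
with respect to the `C^s`-topology. The transverse Poisson structure is a germ, so stability
is required of its restriction to every (arbitrarily small) neighbourhood of `m₀` in the
transversal. -/
def IsKStableTransverse (s k : ℕ) (m₀ : M) : Prop :=
  ∃ (r : ℕ) (V : Set (EuclideanSpace ℝ (Fin r))) (j : EuclideanSpace ℝ (Fin r) → M)
    (π : BivectorField V), L.IsTransversePoisson m₀ V j π ∧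
    ∀ (V' : Set (EuclideanSpace ℝ (Fin r))) (hV' : V' ⊆ V), IsOpen V' → 0 ∈ V' →
      (π.restrict hV').IsKStable s k 0

end DiracStructure

end Manifolds

end DiracStability

end

open scoped Manifold ContDiff Topology

noncomputable section

namespace DiracStability


/-! ### Linear differential equations -/

section LinearODE

open Set Filter Module

/-! Only a small piece of the transversal `N` at `m₀` matters. In a suitable chart it is linear, the
image of an injective map `ℓ`; let `p` be the quotient map by this image. Where `(X, ξ) ↦ (p X, ξ ∘
ℓ)` restricts to an isomorphism on `L`, its inverse at `(0, α)` is the element of `L` whose vector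
part is tangent to `N` and whose covector part restricts to `α`. The induced bivector is thus an
explicit smooth function of the values of a frame of `L` (`frameBivector`). Being an isomorphism is
an open condition, and transversality gives it at `m₀`.

Hence a Dirac structure `L'` with a frame that is `C^{2k}`-close to a frame of `L` on a compact
piece of `N` induces there a bivector `π'` that is `C^{2k}`-close to `π`, without loss of
derivatives (`exists_forall_iteratedFDeriv_comp_sub_lt`). Isotropy and involutivity of `L'` make
`π'` Poisson (`transverseBivector_jacobi`). By `k`-stability `π'` has a singularity of order `k`
close to `m₀`. As `k ≥ 1`, `π'` vanishes there, so the characteristic distribution of `L'` is a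
complement of `N` at that point and has dimension `n - r = dim S`
(`finrank_map_fst_of_transverseBivector_eq_zero`).

It remains to see that this is the dimension of the whole leaf. Along an integral curve of a section
of `L'`, involutivity turns the vector part `Y` of a frame into a solution of a linear equation `Y'
= A Y + Y C`, and such a solution has constant rank (`eventually_finrank_range_eq`,
`IsDiracOn.finrank_fst_eq_of_integralCurve`). -/

theorem exists_fundamentalSolution {G : Type*} [NormedAddCommGroup G] [NormedSpace ℝ G]
    [CompleteSpace G] {A : ℝ → G →L[ℝ] G} {t₀ : ℝ} (hA : ∀ᶠ t in 𝓝 t₀, ContinuousAt A t) :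
    ∃ Φ : ℝ → G →L[ℝ] G, Φ t₀ = 1 ∧ ∀ᶠ t in 𝓝 t₀, HasDerivAt Φ ((A t).comp (Φ t)) t := by
  have hbd : ∀ᶠ t in 𝓝 t₀, ‖A t‖ ≤ ‖A t₀‖ + 1 :=
    (hA.self_of_nhds.norm.eventually_lt_const (lt_add_one _)).mono fun _ h => h.le
  obtain ⟨δ, hδ, hball⟩ := Metric.eventually_nhds_iff_ball.mp (hA.and hbd)
  set M : ℝ := ‖A t₀‖ + 1 with hM
  have hMpos : 0 < M := by positivity
  -- `N` bounds `A t ∘ Z` for `Z` in the unit ball about the identity, so a solution stays in that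
  -- ball for time `1 / N`. The norm of the identity is kept because `G` may be trivial.
  set N : ℝ := M * (‖(1 : G →L[ℝ] G)‖ + 1) with hN
  have hNpos : 0 < N := by positivity
  set ε : ℝ := min (δ / 2) (1 / N) with hε
  have hεpos : 0 < ε := by positivity
  have hsub : ∀ t ∈ Icc (t₀ - ε) (t₀ + ε), t ∈ Metric.ball t₀ δ := fun t ht => by
    rw [Metric.mem_ball, Real.dist_eq, abs_lt]
    have := min_le_left (δ / 2) (1 / N)
    constructor <;> linarith [ht.1, ht.2]
  have hpl : IsPicardLindelof (fun t (Z : G →L[ℝ] G) => (A t).comp Z)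
      (tmin := t₀ - ε) (tmax := t₀ + ε) ⟨t₀, by constructor <;> linarith⟩ 1 1 0
      ⟨N, hNpos.le⟩ ⟨M, hMpos.le⟩ := by
    refine ⟨fun t ht => ?_, fun Z _ t ht => ?_, fun t ht Z hZ => ?_, ?_⟩
    · refine (LipschitzWith.of_dist_le_mul fun Z Z' => ?_).lipschitzOnWith
      rw [dist_eq_norm, dist_eq_norm, ← ContinuousLinearMap.comp_sub]
      exact (ContinuousLinearMap.opNorm_comp_le _ _).trans
        (mul_le_mul_of_nonneg_right (hball t (hsub t ht)).2 (norm_nonneg _))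
    · exact ((hball t (hsub t ht)).1.clm_comp continuousAt_const).continuousWithinAt
    · refine (ContinuousLinearMap.opNorm_comp_le _ _).trans ?_
      have h1 : ‖Z‖ ≤ ‖(1 : G →L[ℝ] G)‖ + 1 := by
        have h2 : ‖Z - 1‖ ≤ 1 := by simpa [dist_eq_norm] using hZ
        calc ‖Z‖ = ‖1 + (Z - 1)‖ := by congr 1; abel
          _ ≤ _ := (norm_add_le _ _).trans (by gcongr)
      exact mul_le_mul (hball t (hsub t ht)).2 h1 (norm_nonneg _) hMpos.le
    · have h1 : ε ≤ 1 / N := min_le_right _ _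
      have h2 : N * ε ≤ 1 := by
        calc N * ε ≤ N * (1 / N) := by gcongr
          _ = 1 := by field_simp
      simp only [add_sub_cancel_left, sub_sub_cancel, max_self, NNReal.coe_one, NNReal.coe_zero,
        sub_zero]
      exact h2
  obtain ⟨Φ, h0, hΦ⟩ := hpl.exists_eq_forall_mem_Icc_hasDerivWithinAt₀
  refine ⟨Φ, h0, ?_⟩
  filter_upwards [Icc_mem_nhds (show t₀ - ε / 2 < t₀ by linarith) (show t₀ < t₀ + ε / 2 by linarith)]
    with t ht
  exact (hΦ t ⟨by linarith [ht.1], by linarith [ht.2]⟩).hasDerivAt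
    (Icc_mem_nhds (by linarith [ht.1]) (by linarith [ht.2]))

/-- Units form an open set. Invertibility close to `t₀` is enough, since the rank only has to be
locally constant. -/
theorem eventually_isUnit_of_eq_one {R : Type*} [NormedRing R] [HasSummableGeomSeries R]
    {Φ : ℝ → R} {t₀ : ℝ} (h1 : Φ t₀ = 1) (h : ContinuousAt Φ t₀) :
    ∀ᶠ t in 𝓝 t₀, IsUnit (Φ t) :=
  h.eventually_mem (Units.isOpen.mem_nhds (by rw [h1]; exact isUnit_one))

/-- The rank of a solution of `Y' = A Y + Y C` is locally constant. -/
theorem eventually_finrank_range_eq {Q E : Type*} [NormedAddCommGroup Q] [NormedSpace ℝ Q]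
    [CompleteSpace Q] [NormedAddCommGroup E] [NormedSpace ℝ E] [CompleteSpace E]
    {Y : ℝ → Q →L[ℝ] E} {A : ℝ → E →L[ℝ] E} {C : ℝ → Q →L[ℝ] Q} {t₀ : ℝ}
    (hA : ∀ᶠ t in 𝓝 t₀, ContinuousAt A t) (hC : ∀ᶠ t in 𝓝 t₀, ContinuousAt C t)
    (hY : ∀ᶠ t in 𝓝 t₀, HasDerivAt Y ((A t).comp (Y t) + (Y t).comp (C t)) t) :
    ∀ᶠ t in 𝓝 t₀, finrank ℝ (LinearMap.range (Y t : Q →ₗ[ℝ] E)) =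
      finrank ℝ (LinearMap.range (Y t₀ : Q →ₗ[ℝ] E)) := by
  obtain ⟨U, hU0, hU⟩ := exists_fundamentalSolution hA
  obtain ⟨Φ, hΦ0, hΦ⟩ := exists_fundamentalSolution (A := fun t => -C t)
    (hC.mono fun t ht => ht.neg)
  have hbd : ∀ᶠ t in 𝓝 t₀, ‖A t‖ ≤ ‖A t₀‖ + 1 :=
    (hA.self_of_nhds.norm.eventually_lt_const (lt_add_one _)).mono fun _ h => h.le
  -- Since `Φ' = -C Φ`, the terms with `C` cancel in `(Y Φ)'`. Both sides therefore solve `Z' = A Z`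
  -- with value `Y t₀` at `t₀`. As `Φ t` and `U t` are invertible, `U t` then carries the range of
  -- `Y t₀` isomorphically onto that of `Y t`.
  have key : (fun t => (Y t).comp (Φ t)) =ᶠ[𝓝 t₀] fun t => (U t).comp (Y t₀) := by
    refine ODE_solution_unique_of_eventually (v := fun t (Z : Q →L[ℝ] E) => (A t).comp Z)
      (s := fun _ => univ) (K := ⟨‖A t₀‖ + 1, by positivity⟩) ?_ ?_ ?_ ?_
    · filter_upwards [hbd] with t ht
      refine (LipschitzWith.of_dist_le_mul fun Z Z' => ?_).lipschitzOnWith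
      rw [dist_eq_norm, dist_eq_norm, ← ContinuousLinearMap.comp_sub]
      exact (ContinuousLinearMap.opNorm_comp_le _ _).trans
        (mul_le_mul_of_nonneg_right ht (norm_nonneg _))
    · filter_upwards [hY, hΦ] with t h1 h2
      refine ⟨?_, mem_univ _⟩
      refine (h1.clm_comp h2).congr_deriv ?_
      ext w
      simp
    · filter_upwards [hU] with t h1
      refine ⟨?_, mem_univ _⟩
      refine (h1.clm_comp (hasDerivAt_const t (Y t₀))).congr_deriv ?_
      ext w
      simp
    · ext w
      simp [hU0, hΦ0]
  filter_upwards [key, eventually_isUnit_of_eq_one hU0 hU.self_of_nhds.continuousAt,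
    eventually_isUnit_of_eq_one hΦ0 hΦ.self_of_nhds.continuousAt] with t h1 h2 h3
  have hu := (ContinuousLinearMap.isUnit_iff_bijective.mp h2).1
  obtain ⟨v, hv⟩ := ContinuousLinearMap.isUnit_iff_bijective.mp h3
  have e1 : LinearMap.range (Y t : Q →ₗ[ℝ] E) =
      (LinearMap.range (Y t₀ : Q →ₗ[ℝ] E)).map (U t : E →ₗ[ℝ] E) := by
    rw [← LinearMap.range_comp, ← LinearMap.range_comp_of_range_eq_top
      (Y t : Q →ₗ[ℝ] E) (LinearMap.range_eq_top.2 hv)]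
    exact congrArg (fun Z : Q →L[ℝ] E => LinearMap.range (Z : Q →ₗ[ℝ] E)) h1
  rw [e1]
  exact (Submodule.equivMapOfInjective (U t : E →ₗ[ℝ] E) hu _).finrank_eq.symm

end LinearODE


/-! ### Normalized frames -/

section NormalizedFrame

open Set Filter Module

variable {W Q : Type*} [NormedAddCommGroup W] [NormedSpace ℝ W] [NormedAddCommGroup Q]
  [NormedSpace ℝ Q] {r : ℕ}

variable (W r) in
/-- The linear map `c ↦ ∑ cᵢ eᵢ` of a family of vectors `e`, depending linearly on `e`. -/
def frameMap : (Fin r → W) →L[ℝ] ((Fin r → ℝ) →L[ℝ] W) :=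
  ∑ i, (ContinuousLinearMap.smulRightL ℝ (Fin r → ℝ) W (ContinuousLinearMap.proj i)).comp
    (ContinuousLinearMap.proj i)

theorem frameMap_apply (e : Fin r → W) (c : Fin r → ℝ) : frameMap W r e c = ∑ i, c i • e i := by
  simp [frameMap]

theorem range_frameMap (e : Fin r → W) :
    LinearMap.range (frameMap W r e : (Fin r → ℝ) →ₗ[ℝ] W) = Submodule.span ℝ (range e) := by
  ext w
  rw [Submodule.mem_span_range_iff_exists_fun]
  simp [frameMap_apply]

/-- The family of vectors `e` as a section of the linear map `q`: the inverse of the restriction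
of `q` to the span of `e`. -/
def normalizeFrame (q : W →L[ℝ] Q) (e : Fin r → W) : Q →L[ℝ] W :=
  (frameMap W r e).comp (q.comp (frameMap W r e)).inverse

/-- The families of vectors which are mapped to a basis by `q`. -/
def regularFrames (q : W →L[ℝ] Q) (r : ℕ) : Set (Fin r → W) :=
  {e | (q.comp (frameMap W r e)).IsInvertible}

variable {q : W →L[ℝ] Q} {e : Fin r → W}

theorem isOpen_regularFrames : IsOpen (regularFrames q r) :=
  ContinuousLinearEquiv.isOpen.preimage (by fun_prop :
    Continuous fun e : Fin r → W => q.comp (frameMap W r e))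

theorem comp_normalizeFrame (he : e ∈ regularFrames q r) :
    q.comp (normalizeFrame q e) = ContinuousLinearMap.id ℝ Q := by
  rw [normalizeFrame, ← ContinuousLinearMap.comp_assoc]
  exact he.self_comp_inverse

theorem range_normalizeFrame (he : e ∈ regularFrames q r) :
    LinearMap.range (normalizeFrame q e : Q →ₗ[ℝ] W) = Submodule.span ℝ (range e) := by
  rw [← range_frameMap]
  exact LinearMap.range_comp_of_range_eq_top _
    (LinearMap.range_eq_top.2 he.inverse.surjective)

/-- Inversion of operators is smooth at invertible ones. This smooth dependence on the frame alone
is what later converts closeness of frames into closeness of bivectors. -/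
theorem contDiffAt_normalizeFrame {n : WithTop ℕ∞} (he : e ∈ regularFrames q r) :
    ContDiffAt ℝ n (normalizeFrame q) e := by
  have h1 : ContDiff ℝ n fun e : Fin r → W => frameMap W r e := (frameMap W r).contDiff
  have h2 : ContDiffAt ℝ n (fun e : Fin r → W => (q.comp (frameMap W r e)).inverse) e :=
    ContDiffAt.comp (f := fun e : Fin r → W => q.comp (frameMap W r e)) e
      (ContinuousLinearMap.IsInvertible.contDiffAt_map_inverse he)
      (contDiff_const.clm_comp h1).contDiffAt
  exact h1.contDiffAt.clm_comp h2

theorem ker_frameMap (he : finrank ℝ (Submodule.span ℝ (range e)) = r) :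
    LinearMap.ker (frameMap W r e : (Fin r → ℝ) →ₗ[ℝ] W) = ⊥ := by
  have h := LinearMap.finrank_range_add_finrank_ker (frameMap W r e : (Fin r → ℝ) →ₗ[ℝ] W)
  rw [range_frameMap, he, finrank_fin_fun] at h
  exact Submodule.finrank_eq_zero.1 (by omega)

theorem mem_regularFrames [FiniteDimensional ℝ Q] {D : Submodule ℝ W}
    (hspan : Submodule.span ℝ (range e) = D) (hD : finrank ℝ D = r) (hQ : finrank ℝ Q = r)
    (hq : ∀ w ∈ D, q w = 0 → w = 0) : e ∈ regularFrames q r := by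
  have hr : LinearMap.range (frameMap W r e : (Fin r → ℝ) →ₗ[ℝ] W) = D := by
    rw [range_frameMap, hspan]
  have hinj := ker_frameMap (e := e) (by rw [hspan, hD])
  have hinj' : Function.Injective (q.comp (frameMap W r e)) := by
    rw [injective_iff_map_eq_zero]
    intro c hc
    have h0 := hq (frameMap W r e c) (hr ▸ LinearMap.mem_range_self _ c) hc
    exact (Submodule.mem_bot ℝ).1 (hinj ▸ LinearMap.mem_ker.2 h0)
  have hdim : finrank ℝ (Fin r → ℝ) = finrank ℝ Q := by rw [finrank_fin_fun, hQ]
  exact ⟨(LinearEquiv.ofInjectiveOfFinrankEq (q.comp (frameMap W r e) : (Fin r → ℝ) →ₗ[ℝ] Q)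
    hinj' hdim).toContinuousLinearEquiv, by ext1 c; rfl⟩

end NormalizedFrame

/-! ### Involutivity and the rank of the characteristic distribution along integral curves. -/

section Local

open Set Filter Module

variable {F : Type*} [NormedAddCommGroup F] [NormedSpace ℝ F]
  {Q : Type*} [NormedAddCommGroup Q] [NormedSpace ℝ Q]

section

variable {W : Type*} [NormedAddCommGroup W] [NormedSpace ℝ W]

/-- A smooth frame over `V` of the field `D` of subspaces of `W`, in the form of a family
of linear maps with image `D` that are sections of a fixed linear map `q`. -/
structure IsNormalizedFrameOn (q : W →L[ℝ] Q) (D : F → Submodule ℝ W) (V : Set F)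
    (σ : F → Q →L[ℝ] W) : Prop where
  isOpen : IsOpen V
  smooth : ContDiffOn ℝ ∞ σ V
  comp_eq : ∀ x ∈ V, q.comp (σ x) = ContinuousLinearMap.id ℝ Q
  range_eq : ∀ x ∈ V, LinearMap.range (σ x : Q →ₗ[ℝ] W) = D x

namespace IsNormalizedFrameOn

variable {q : W →L[ℝ] Q} {D : F → Submodule ℝ W} {V : Set F} {σ : F → Q →L[ℝ] W} {x : F}

theorem contDiffAt (h : IsNormalizedFrameOn q D V σ) (hx : x ∈ V) : ContDiffAt ℝ ∞ σ x :=
  h.smooth.contDiffAt (h.isOpen.mem_nhds hx)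

theorem hasFDerivAt (h : IsNormalizedFrameOn q D V σ) (hx : x ∈ V) :
    HasFDerivAt σ (fderiv ℝ σ x) x :=
  ((h.contDiffAt hx).differentiableAt (by simp)).hasFDerivAt

theorem hasDerivAt_comp (h : IsNormalizedFrameOn q D V σ) {γ : ℝ → F} {t : ℝ} {v : F}
    (ht : γ t ∈ V) (hγ : HasDerivAt γ v t) :
    HasDerivAt (fun u => σ (γ u)) (fderiv ℝ σ (γ t) v) t :=
  (h.hasFDerivAt ht).comp_hasDerivAt t hγ

theorem hasDerivAt_clm_comp (h : IsNormalizedFrameOn q D V σ) {G : Type*} [NormedAddCommGroup G]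
    [NormedSpace ℝ G] (p : W →L[ℝ] G) {γ : ℝ → F} {t : ℝ} {v : F}
    (ht : γ t ∈ V) (hγ : HasDerivAt γ v t) :
    HasDerivAt (fun u => p.comp (σ (γ u))) (p.comp (fderiv ℝ σ (γ t) v)) t :=
  ((hasDerivAt_const t p).clm_comp (h.hasDerivAt_comp ht hγ)).congr_deriv (by simp)

theorem apply_mem (h : IsNormalizedFrameOn q D V σ) (hx : x ∈ V) (w : Q) : σ x w ∈ D x :=
  h.range_eq x hx ▸ LinearMap.mem_range_self _ w

theorem apply_eq (h : IsNormalizedFrameOn q D V σ) (hx : x ∈ V) {u : W}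
    (hu : u ∈ D x) : σ x (q u) = u := by
  rw [← h.range_eq x hx] at hu
  obtain ⟨w, rfl⟩ := hu
  exact congrArg (σ x) (DFunLike.congr_fun (h.comp_eq x hx) w)

theorem map_apply (h : IsNormalizedFrameOn q D V σ) (hx : x ∈ V) (w : Q) : q (σ x w) = w :=
  DFunLike.congr_fun (h.comp_eq x hx) w

/-- `q ∘ σ` is constantly the identity, so derivatives of `σ` take values in the kernel of `q`. This
is the benefit of normalizing: applying `q` to a bracket leaves only its zeroth order part. -/
theorem map_fderiv_apply (h : IsNormalizedFrameOn q D V σ) (hx : x ∈ V) (v : F) (w : Q) :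
    q (fderiv ℝ σ x v w) = 0 := by
  have h1 : HasFDerivAt (fun y => q (σ y w)) _ x :=
    q.hasFDerivAt.comp x ((h.hasFDerivAt hx).clm_apply (hasFDerivAt_const w x))
  have h2 : (fun y => q (σ y w)) =ᶠ[𝓝 x] fun _ => w := by
    filter_upwards [h.isOpen.mem_nhds hx] with y hy using h.map_apply hy w
  have h3 := DFunLike.congr_fun (h1.unique ((hasFDerivAt_const w x).congr_of_eventuallyEq h2)) v
  simpa using h3

end IsNormalizedFrameOn

end

variable {q : F × (F →L[ℝ] ℝ) →L[ℝ] Q} {D : F → Submodule ℝ (F × (F →L[ℝ] ℝ))} {U V : Set F}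

theorem IsSmoothFrameOn.isNormalizedFrameOn {r : ℕ} {e : Fin r → F → F × (F →L[ℝ] ℝ)}
    (he : IsSmoothFrameOn D V e) {V' : Set F} (hV' : IsOpen V') (hsub : V' ⊆ V)
    (hreg : ∀ x ∈ V', (fun i => e i x) ∈ regularFrames q r) :
    IsNormalizedFrameOn q D V' fun x => normalizeFrame q fun i => e i x where
  isOpen := hV'
  smooth x hx := by
    have h1 : ContDiffWithinAt ℝ ∞ (fun x i => e i x) V' x :=
      contDiffWithinAt_pi.2 fun i => (he.smooth i).mono hsub x hx
    exact (contDiffAt_normalizeFrame (hreg x hx)).comp_contDiffWithinAt x h1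
  comp_eq x hx := comp_normalizeFrame (hreg x hx)
  range_eq x hx := by rw [range_normalizeFrame (hreg x hx), he.span_eq x (hsub hx)]

theorem IsSmoothFrameOn.isOpen_regular {r : ℕ} {e : Fin r → F → F × (F →L[ℝ] ℝ)}
    (he : IsSmoothFrameOn D V e) (hV : IsOpen V) (q : F × (F →L[ℝ] ℝ) →L[ℝ] Q) :
    IsOpen (V ∩ (fun x i => e i x) ⁻¹' regularFrames q r) :=
  (continuousOn_pi.2 fun i => (he.smooth i).continuousOn).isOpen_inter_preimage hV
    isOpen_regularFrames

/-- The zeroth order part of the Courant bracket with a section of derivative `S`. -/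
def courantOperator (S : F →L[ℝ] F × (F →L[ℝ] ℝ)) :
    F × (F →L[ℝ] ℝ) →L[ℝ] F × (F →L[ℝ] ℝ) :=
  let DX := (ContinuousLinearMap.fst ℝ F (F →L[ℝ] ℝ)).comp S
  let Dα := (ContinuousLinearMap.snd ℝ F (F →L[ℝ] ℝ)).comp S
  (ContinuousLinearMap.inl ℝ F (F →L[ℝ] ℝ)).comp
      (-(DX.comp (ContinuousLinearMap.fst ℝ F (F →L[ℝ] ℝ)))) +
    (ContinuousLinearMap.inr ℝ F (F →L[ℝ] ℝ)).comp
      (((ContinuousLinearMap.compL ℝ F F ℝ).flip DX).comp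
          (ContinuousLinearMap.snd ℝ F (F →L[ℝ] ℝ)) -
        Dα.comp (ContinuousLinearMap.fst ℝ F (F →L[ℝ] ℝ)) +
        Dα.flip.comp (ContinuousLinearMap.fst ℝ F (F →L[ℝ] ℝ)))

theorem continuous_courantOperator : Continuous (courantOperator (F := F)) := by
  have h1 : Continuous fun S : F →L[ℝ] F × (F →L[ℝ] ℝ) =>
      (ContinuousLinearMap.fst ℝ F (F →L[ℝ] ℝ)).comp S := continuous_const.clm_comp continuous_id
  have h2 : Continuous fun S : F →L[ℝ] F × (F →L[ℝ] ℝ) =>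
      (ContinuousLinearMap.snd ℝ F (F →L[ℝ] ℝ)).comp S := continuous_const.clm_comp continuous_id
  have h3 := (ContinuousLinearMap.flipₗᵢ ℝ F F ℝ).continuous.comp h2
  have h4 := ((ContinuousLinearMap.compL ℝ F F ℝ).flip).continuous.comp h1
  exact (continuous_const.clm_comp (h1.clm_comp continuous_const).neg).add
    (continuous_const.clm_comp (((h4.clm_comp continuous_const).sub
      (h2.clm_comp continuous_const)).add (h3.clm_comp continuous_const)))

/-- For constant `w`, the bracket is the derivative of `σ w` along the vector part of `s`, plus a
term algebraic in `σ w` with coefficients from the derivative of `s`. -/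
theorem courantBracket_const_apply {s : F → F × (F →L[ℝ] ℝ)} {σ : F → Q →L[ℝ] F × (F →L[ℝ] ℝ)}
    {x : F} (hs : DifferentiableAt ℝ s x) (hσ : DifferentiableAt ℝ σ x) (w : Q) :
    courantBracket s (fun y => σ y w) x =
      fderiv ℝ σ x (s x).1 w + courantOperator (fderiv ℝ s x) (σ x w) := by
  have h1 : HasFDerivAt (fun y => σ y w) ((fderiv ℝ σ x).flip w) x := by
    refine (hσ.hasFDerivAt.clm_apply (hasFDerivAt_const w x)).congr_fderiv ?_
    ext v <;> simp
  have h2 := hs.hasFDerivAt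
  simp only [courantBracket, VectorField.lieBracket, lieDerivForm, contractExtDeriv,
    h1.fst.fderiv, h1.snd.fderiv, h2.fst.fderiv, h2.snd.fderiv]
  ext v <;> simp [courantOperator, sub_eq_add_neg]
  abel

/-- Take for `q` a left inverse of the frame map at `x` itself. The frame is then regular at `x`,
hence on a neighbourhood. -/
theorem IsDiracOn.exists_isNormalizedFrameOn [FiniteDimensional ℝ F] (hD : IsDiracOn U D) {x : F}
    (hx : x ∈ U) : ∃ (q : F × (F →L[ℝ] ℝ) →L[ℝ] (Fin (finrank ℝ F) → ℝ)) (V : Set F)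
      (σ : F → (Fin (finrank ℝ F) → ℝ) →L[ℝ] F × (F →L[ℝ] ℝ)),
      x ∈ V ∧ IsNormalizedFrameOn q D V σ := by
  obtain ⟨V, hV, hxV, hVU, e, he⟩ := hD.smooth x hx
  have hker : LinearMap.ker (frameMap _ _ fun i => e i x).toLinearMap = ⊥ :=
    ker_frameMap (by rw [he.span_eq x hxV, hD.rank x hx])
  obtain ⟨q, hq⟩ := LinearMap.exists_leftInverse_of_injective _ hker
  refine ⟨LinearMap.toContinuousLinearMap q, _, _, ?_,
    he.isNormalizedFrameOn (he.isOpen_regular hV _) inter_subset_left fun y hy => hy.2⟩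
  refine ⟨hxV, ?_⟩
  refine ⟨ContinuousLinearEquiv.refl ℝ _, ?_⟩
  ext1 c
  exact (DFunLike.congr_fun hq c).symm

/-- Derivative of the vector field components of a normalized frame along a section. -/
theorem IsDiracOn.fst_fderiv_apply (hD : IsDiracOn U D) {σ : F → Q →L[ℝ] F × (F →L[ℝ] ℝ)}
    (hσ : IsNormalizedFrameOn q D V σ) {V' : Set F} (hV' : IsOpen V') (hV'U : V' ⊆ U)
    {s : F → F × (F →L[ℝ] ℝ)} (hs : ContDiffOn ℝ ∞ s V') (hsD : ∀ y ∈ V', s y ∈ D y) {x : F}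
    (hx : x ∈ V) (hx' : x ∈ V') (w : Q) :
    (fderiv ℝ σ x (s x).1 w).1 = (fderiv ℝ s x (σ x w).1).1 +
      (σ x (q (courantOperator (fderiv ℝ s x) (σ x w)))).1 := by
  have hs' : DifferentiableAt ℝ s x :=
    (hs.contDiffAt (hV'.mem_nhds hx')).differentiableAt (by simp)
  have hb := courantBracket_const_apply hs' (hσ.hasFDerivAt hx).differentiableAt w
  have hmem : courantBracket s (fun y => σ y w) x ∈ D x :=
    hD.involutive (V ∩ V') (hσ.isOpen.inter hV') (fun y hy => hV'U hy.2) s (fun y => σ y w)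
      (hs.mono inter_subset_right)
      ((hσ.smooth.clm_apply contDiffOn_const).mono inter_subset_left)
      (fun y hy => hsD y hy.2) (fun y hy => hσ.apply_mem hy.1 w) x ⟨hx, hx'⟩
  -- The bracket lies in `D`, so it is `σ` applied to its image under `q`, and `q` kills the
  -- derivative term.
  have h1 := hσ.apply_eq hx hmem
  rw [hb, map_add, hσ.map_fderiv_apply hx, zero_add] at h1
  have h2 := congrArg Prod.fst h1
  rw [h2]
  simp [courantOperator]

/-- Derivative of the vector field components of a normalized frame along a multiple of a section,
as a linear map. -/
theorem IsDiracOn.fst_comp_fderiv (hD : IsDiracOn U D) {σ : F → Q →L[ℝ] F × (F →L[ℝ] ℝ)}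
    (hσ : IsNormalizedFrameOn q D V σ) {V' : Set F} (hV' : IsOpen V') (hV'U : V' ⊆ U)
    {s : F → F × (F →L[ℝ] ℝ)} (hs : ContDiffOn ℝ ∞ s V') (hsD : ∀ y ∈ V', s y ∈ D y) {x : F}
    (hx : x ∈ V) (hx' : x ∈ V') (c : ℝ) :
    (ContinuousLinearMap.fst ℝ F (F →L[ℝ] ℝ)).comp (fderiv ℝ σ x (c • (s x).1)) =
      (c • (ContinuousLinearMap.fst ℝ F (F →L[ℝ] ℝ)).comp (fderiv ℝ s x)).comp
          ((ContinuousLinearMap.fst ℝ F (F →L[ℝ] ℝ)).comp (σ x)) +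
        ((ContinuousLinearMap.fst ℝ F (F →L[ℝ] ℝ)).comp (σ x)).comp
          (c • q.comp ((courantOperator (fderiv ℝ s x)).comp (σ x))) := by
  ext w
  have h := hD.fst_fderiv_apply hσ hV' hV'U hs hsD hx hx' w
  simp [h]

/-- The vector part `Y` of a normalized frame along the curve satisfies `Y' = A Y + Y C`, so its
rank is locally constant, hence constant. -/
theorem IsDiracOn.finrank_fst_eq_of_integralCurve [FiniteDimensional ℝ F] (hD : IsDiracOn U D)
    (hV : IsOpen V) (hVU : V ⊆ U)
    {s : F → F × (F →L[ℝ] ℝ)} (hs : ContDiffOn ℝ ∞ s V) (hsD : ∀ y ∈ V, s y ∈ D y) {γ : ℝ → F}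
    (hγ : ∀ t ∈ Icc (0 : ℝ) 1, γ t ∈ V ∧ HasDerivWithinAt γ (s (γ t)).1 (Icc (0 : ℝ) 1) t) :
    finrank ℝ ((D (γ 0)).map (LinearMap.fst ℝ F (F →L[ℝ] ℝ))) =
      finrank ℝ ((D (γ 1)).map (LinearMap.fst ℝ F (F →L[ℝ] ℝ))) := by
  -- Reparametrizing by `sin²` gives a curve on all of `ℝ` with two-sided derivatives, although `γ`
  -- is controlled only on `[0, 1]` and one-sidedly at its ends. It takes the values `γ 0` and `γ 1`
  -- at `0` and `π / 2`.
  set τ : ℝ → ℝ := fun t => Real.sin t ^ 2 with hτ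
  have hτmem : ∀ t, τ t ∈ Icc (0 : ℝ) 1 := fun t => ⟨sq_nonneg _, Real.sin_sq_le_one t⟩
  set g : ℝ → ℝ := fun t => 2 * Real.sin t * Real.cos t with hg
  have hτd : ∀ t, HasDerivAt τ (g t) t := fun t => by
    exact ((Real.hasDerivAt_sin t).pow 2).congr_deriv (by simp [hg])
  set Γ : ℝ → F := γ ∘ τ with hΓ
  have hΓV : ∀ t, Γ t ∈ V := fun t => (hγ _ (hτmem t)).1
  have hΓd : ∀ t, HasDerivAt Γ (g t • (s (Γ t)).1) t := fun t => by
    have h1 := (hγ _ (hτmem t)).2.scomp t (hτd t).hasDerivWithinAt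
      (fun u (_ : u ∈ univ) => hτmem u)
    exact hasDerivWithinAt_univ.1 h1
  set ρ : ℝ → ℕ := fun t => finrank ℝ ((D (Γ t)).map (LinearMap.fst ℝ F (F →L[ℝ] ℝ))) with hρ
  have hloc : IsLocallyConstant ρ := by
    rw [IsLocallyConstant.iff_eventually_eq]
    intro t₀
    obtain ⟨q, V₁, σ, hx₁, hσ⟩ := hD.exists_isNormalizedFrameOn (hVU (hΓV t₀))
    have hΓc : Continuous Γ := continuous_iff_continuousAt.2 fun t => (hΓd t).continuousAt
    have hmem : ∀ᶠ t in 𝓝 t₀, Γ t ∈ V₁ :=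
      hΓc.continuousAt.eventually_mem (hσ.isOpen.mem_nhds hx₁)
    set Y : ℝ → (Fin (finrank ℝ F) → ℝ) →L[ℝ] F :=
      fun t => (ContinuousLinearMap.fst ℝ F (F →L[ℝ] ℝ)).comp (σ (Γ t)) with hY
    have hgc : Continuous g := by fun_prop
    have hS : ∀ t, ContinuousAt (fun t => fderiv ℝ s (Γ t)) t := fun t =>
      ContinuousAt.comp (f := Γ) (((hs.continuousOn_fderiv_of_isOpen hV (by simp)).continuousAt
        (hV.mem_nhds (hΓV t)))) hΓc.continuousAt
    have hrank := eventually_finrank_range_eq (Y := Y) (t₀ := t₀)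
      (A := fun t => g t • (ContinuousLinearMap.fst ℝ F (F →L[ℝ] ℝ)).comp (fderiv ℝ s (Γ t)))
      (C := fun t => g t • q.comp ((courantOperator (fderiv ℝ s (Γ t))).comp (σ (Γ t))))
      (Eventually.of_forall fun t => hgc.continuousAt.smul (continuousAt_const.clm_comp (hS t)))
      (by
        filter_upwards [hmem] with t ht
        refine hgc.continuousAt.smul (continuousAt_const.clm_comp (ContinuousAt.clm_comp ?_ ?_))
        · exact continuous_courantOperator.continuousAt.comp (hS t)
        · exact ContinuousAt.comp (f := Γ) (hσ.contDiffAt ht).continuousAt hΓc.continuousAt)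
      (by
        filter_upwards [hmem] with t ht
        have h1 := hσ.hasDerivAt_clm_comp (ContinuousLinearMap.fst ℝ F (F →L[ℝ] ℝ)) ht (hΓd t)
        rw [hD.fst_comp_fderiv hσ hV hVU hs hsD ht (hΓV t)] at h1
        exact h1)
    filter_upwards [hrank, hmem] with t ht htm
    have h3 : ∀ u, Γ u ∈ V₁ → (D (Γ u)).map (LinearMap.fst ℝ F (F →L[ℝ] ℝ)) =
        LinearMap.range (Y u : (Fin (finrank ℝ F) → ℝ) →ₗ[ℝ] F) := fun u hu => by
      rw [← hσ.range_eq _ hu, ← LinearMap.range_comp]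
      rfl
    simp only [hρ]
    rw [h3 t htm, ht, h3 t₀ hx₁]
  have h := hloc.apply_eq_of_preconnectedSpace 0 (Real.pi / 2)
  have h0 : Γ 0 = γ 0 := by simp [hΓ, hτ]
  have h1 : Γ (Real.pi / 2) = γ 1 := by simp [hΓ, hτ]
  rw [← h0, ← h1]
  exact h

end Local


/-! ### The dimension of the leaves -/

section Leaves

open Set Filter Module

variable {n : ℕ} {M : Type*} [TopologicalSpace M] [ChartedSpace (EuclideanSpace ℝ (Fin n)) M]

theorem mdifferentiable_of_mem_maximalAtlas [IsManifold (𝓡 n) ∞ M]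
    {φ : OpenPartialHomeomorph M (EuclideanSpace ℝ (Fin n))}
    (hφ : φ ∈ IsManifold.maximalAtlas (𝓡 n) ∞ M) : φ.MDifferentiable (𝓡 n) (𝓡 n) :=
  ⟨(contMDiffOn_of_mem_maximalAtlas hφ).mdifferentiableOn (by simp),
    (contMDiffOn_symm_of_mem_maximalAtlas hφ).mdifferentiableOn (by simp)⟩

theorem mem_inChart
    {L : (x : M) → Submodule ℝ (TangentSpace (𝓡 n) x × (TangentSpace (𝓡 n) x →L[ℝ] ℝ))}
    {φ : OpenPartialHomeomorph M (EuclideanSpace ℝ (Fin n))} {z : EuclideanSpace ℝ (Fin n)}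
    {p : EuclideanSpace ℝ (Fin n) × (EuclideanSpace ℝ (Fin n) →L[ℝ] ℝ)} :
    p ∈ inChart L φ z ↔ ∃ ξ : TangentSpace (𝓡 n) (φ.symm z) →L[ℝ] ℝ,
      (mfderiv (𝓡 n) (𝓡 n) φ.symm z p.1, ξ) ∈ L (φ.symm z) ∧
        p.2 = ξ.comp (mfderiv (𝓡 n) (𝓡 n) φ.symm z) :=
  Iff.rfl

namespace DiracStructure

variable [IsManifold (𝓡 n) ∞ M] (L : DiracStructure n M)

theorem finrank_map_fst_inChart {φ : OpenPartialHomeomorph M (EuclideanSpace ℝ (Fin n))}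
    (hφ : φ ∈ IsManifold.maximalAtlas (𝓡 n) ∞ M) {z : EuclideanSpace ℝ (Fin n)}
    (hz : z ∈ φ.target) :
    finrank ℝ ((inChart L.fiber φ z).map (LinearMap.fst ℝ (EuclideanSpace ℝ (Fin n))
      (EuclideanSpace ℝ (Fin n) →L[ℝ] ℝ))) = finrank ℝ (L.charDist (φ.symm z)) := by
  set d := (mdifferentiable_of_mem_maximalAtlas hφ).symm.mfderiv hz with hd
  have h1 : L.charDist (φ.symm z) = ((inChart L.fiber φ z).map (LinearMap.fst ℝ
      (EuclideanSpace ℝ (Fin n)) (EuclideanSpace ℝ (Fin n) →L[ℝ] ℝ))).map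
        (d.toLinearEquiv : TangentSpace (𝓡 n) z →ₗ[ℝ] TangentSpace (𝓡 n) (φ.symm z)) := by
    ext v
    constructor
    · rintro ⟨⟨v', ξ⟩, hv, rfl⟩
      refine ⟨d.symm v', ⟨(d.symm v', ξ.comp (mfderiv (𝓡 n) (𝓡 n) φ.symm z)), ?_, rfl⟩,
        d.apply_symm_apply v'⟩
      refine mem_inChart.2 ⟨ξ, ?_, rfl⟩
      have h2 : mfderiv (𝓡 n) (𝓡 n) φ.symm z (d.symm v') = v' := d.apply_symm_apply v'
      rw [h2]
      exact hv
    · rintro ⟨v', ⟨⟨v'', η⟩, hp, rfl⟩, rfl⟩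
      obtain ⟨ξ, hξ, -⟩ := mem_inChart.1 hp
      exact ⟨_, hξ, rfl⟩
  rw [h1]
  exact (LinearEquiv.finrank_map_eq d.toLinearEquiv _).symm

theorem finrank_charDist_eq_of_joined {x y : M} (h : L.Joined x y) :
    finrank ℝ (L.charDist x) = finrank ℝ (L.charDist y) := by
  obtain ⟨φ, hφ, V, hV, hVt, s, hs, hsL, γ, hγ, rfl, rfl⟩ := h
  rw [← L.finrank_map_fst_inChart hφ (hVt (hγ 0 (by simp)).1),
    ← L.finrank_map_fst_inChart hφ (hVt (hγ 1 (by simp)).1)]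
  exact (L.isDirac φ hφ).finrank_fst_eq_of_integralCurve hV hVt hs hsL hγ

theorem finrank_charDist_eq_of_eqvGen {x y : M} (h : Relation.EqvGen L.Joined x y) :
    finrank ℝ (L.charDist x) = finrank ℝ (L.charDist y) := by
  induction h with
  | rel _ _ h => exact L.finrank_charDist_eq_of_joined h
  | refl _ => rfl
  | symm _ _ _ ih => exact ih.symm
  | trans _ _ _ _ _ ih₁ ih₂ => exact ih₁.trans ih₂

variable {L}

theorem IsLeaf.hasLeafDim {S : Set M} (hS : L.IsLeaf S) {p : M} (hp : p ∈ S) :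
    L.HasLeafDim S (finrank ℝ (L.charDist p)) := by
  obtain ⟨m, rfl⟩ := hS
  intro x hx
  exact (L.finrank_charDist_eq_of_eqvGen hx).symm.trans (L.finrank_charDist_eq_of_eqvGen hp)

/-- Finding a leaf of given dimension is thereby reduced to finding one point where the
characteristic distribution has that rank. -/
theorem exists_isLeaf_hasLeafDim (p : M) :
    ∃ S : Set M, L.IsLeaf S ∧ L.HasLeafDim S (finrank ℝ (L.charDist p)) ∧ p ∈ S := by
  have h : p ∈ {x | Relation.EqvGen L.Joined p x} := Relation.EqvGen.refl p
  exact ⟨_, ⟨p, rfl⟩, IsLeaf.hasLeafDim ⟨p, rfl⟩ h, h⟩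

end DiracStructure

end Leaves


/-! ### Charts adapted to an immersion -/

section AdaptedChart

open Set Filter Module

/-- If `f` is an immersion at `0`, then `f` is a linear map in suitable coordinates of the target. -/
theorem exists_openPartialHomeomorph_comp_eq {G E : Type*} [NormedAddCommGroup G] [NormedSpace ℝ G]
    [FiniteDimensional ℝ G] [NormedAddCommGroup E] [NormedSpace ℝ E] [FiniteDimensional ℝ E]
    {f : G → E} {V : Set G} (hV : IsOpen V) (h0 : 0 ∈ V) (hf : ContDiffOn ℝ ∞ f V)
    (himm : Function.Injective (fderiv ℝ f 0)) :
    ∃ (ψ : OpenPartialHomeomorph E E) (B : G →L[ℝ] E), Function.Injective B ∧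
      0 ∈ ψ.source ∧ ContDiffOn ℝ ∞ ψ ψ.source ∧ ContDiffOn ℝ ∞ ψ.symm ψ.target ∧
      ∀ y, ψ (B y) = f y := by
  set B : G →L[ℝ] E := fderiv ℝ f 0 with hB
  obtain ⟨a', ha'⟩ := LinearMap.exists_leftInverse_of_injective (B : G →ₗ[ℝ] E)
    (LinearMap.ker_eq_bot.2 himm)
  set a : E →L[ℝ] G := LinearMap.toContinuousLinearMap a' with ha
  have haB : ∀ y, a (B y) = y := fun y => LinearMap.congr_fun ha' y
  -- This extends `f` by a translation along the kernel of `a`: `Φ ∘ B = f`, and the derivative of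
  -- `Φ` at `0` is the identity.
  set Φ : E → E := fun x => f (a x) + (x - B (a x)) with hΦ
  set O₁ : Set E := a ⁻¹' V with hO₁
  have hO₁o : IsOpen O₁ := hV.preimage a.continuous
  have h0O₁ : (0 : E) ∈ O₁ := by simpa [hO₁] using h0
  have hΦs : ContDiffOn ℝ ∞ Φ O₁ :=
    (hf.comp a.contDiff.contDiffOn fun x hx => hx).add (by fun_prop)
  have hΦd : fderiv ℝ Φ 0 = ContinuousLinearMap.id ℝ E := by
    have hfd : HasFDerivAt f B (a 0) := by
      rw [map_zero]
      exact ((hf.contDiffAt (hV.mem_nhds h0)).differentiableAt (by simp)).hasFDerivAt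
    have h1 : HasFDerivAt Φ (B.comp a + (ContinuousLinearMap.id ℝ E - B.comp a)) 0 :=
      (hfd.comp 0 a.hasFDerivAt).add ((hasFDerivAt_id 0).sub (B.comp a).hasFDerivAt)
    rw [h1.fderiv]
    abel
  -- Restricting to points with invertible derivative makes the local inverse smooth on its whole
  -- domain, not just at the centre.
  set O : Set E := O₁ ∩ (fderiv ℝ Φ) ⁻¹' range ((↑) : (E ≃L[ℝ] E) → E →L[ℝ] E) with hO
  have hOo : IsOpen O := (hΦs.continuousOn_fderiv_of_isOpen hO₁o (by simp)).isOpen_inter_preimage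
    hO₁o ContinuousLinearEquiv.isOpen
  have h0O : (0 : E) ∈ O := ⟨h0O₁, ContinuousLinearEquiv.refl ℝ E, hΦd.symm⟩
  have hΦ0 : HasFDerivAt Φ ((ContinuousLinearEquiv.refl ℝ E : E ≃L[ℝ] E) : E →L[ℝ] E) 0 := by
    have h1 := ((hΦs.contDiffAt (hO₁o.mem_nhds h0O₁)).differentiableAt (by simp)).hasFDerivAt
    rwa [hΦd] at h1
  set e := (hΦs.contDiffAt (hO₁o.mem_nhds h0O₁)).toOpenPartialHomeomorph Φ hΦ0 (by simp) with he
  refine ⟨e.restr O, B, himm, ?_, ?_, ?_, fun y => ?_⟩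
  · rw [OpenPartialHomeomorph.restr_source, hOo.interior_eq]
    exact ⟨ContDiffAt.mem_toOpenPartialHomeomorph_source _ hΦ0 _, h0O⟩
  · rw [OpenPartialHomeomorph.restr_source, hOo.interior_eq]
    exact hΦs.mono fun x hx => hx.2.1
  · intro z hz
    have hz' : e.symm z ∈ O := by
      have h1 := (e.restr O).map_target hz
      rw [OpenPartialHomeomorph.restr_source, hOo.interior_eq] at h1
      exact h1.2
    obtain ⟨T, hT⟩ := hz'.2
    have h2 : ContDiffAt ℝ ∞ Φ (e.symm z) := hΦs.contDiffAt (hO₁o.mem_nhds hz'.1)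
    have h3 : HasFDerivAt e (T : E →L[ℝ] E) (e.symm z) := by
      rw [hT]
      exact (h2.differentiableAt (by simp)).hasFDerivAt
    exact (e.contDiffAt_symm ((OpenPartialHomeomorph.restr_target _ _).subset hz).1
      h3 h2).contDiffWithinAt
  · change Φ (B y) = f y
    simp [hΦ, haB]

variable {n : ℕ} {M : Type*} [TopologicalSpace M] [ChartedSpace (EuclideanSpace ℝ (Fin n)) M]
  [IsManifold (𝓡 n) ∞ M]

/-- An immersion is linear in a suitable chart of the target manifold. -/
theorem exists_chart_symm_comp_eq {r : ℕ} {V : Set (EuclideanSpace ℝ (Fin r))}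
    {j : EuclideanSpace ℝ (Fin r) → M} (hV : IsOpen V) (h0 : 0 ∈ V)
    (hj : ContMDiffOn (𝓡 r) (𝓡 n) ∞ j V)
    (himm : Function.Injective (mfderiv (𝓡 r) (𝓡 n) j 0)) :
    ∃ φ ∈ IsManifold.maximalAtlas (𝓡 n) ∞ M,
      ∃ B : EuclideanSpace ℝ (Fin r) →L[ℝ] EuclideanSpace ℝ (Fin n), Function.Injective B ∧
      ∃ V' : Set (EuclideanSpace ℝ (Fin r)), IsOpen V' ∧ 0 ∈ V' ∧ V' ⊆ V ∧
        ∀ y ∈ V', B y ∈ φ.target ∧ φ.symm (B y) = j y := by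
  set φ₀ := chartAt (EuclideanSpace ℝ (Fin n)) (j 0) with hφ₀
  have hmem₀ := IsManifold.chart_mem_maximalAtlas (I := 𝓡 n) (n := ∞) (j 0)
  set V₁ : Set (EuclideanSpace ℝ (Fin r)) := V ∩ j ⁻¹' φ₀.source with hV₁
  have hV₁o : IsOpen V₁ := hj.continuousOn.isOpen_inter_preimage hV φ₀.open_source
  have h0V₁ : (0 : EuclideanSpace ℝ (Fin r)) ∈ V₁ := ⟨h0, mem_chart_source _ _⟩
  have hfm : ContMDiffOn (𝓡 r) (𝓡 n) ∞ (φ₀ ∘ j) V₁ :=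
    (contMDiffOn_of_mem_maximalAtlas hmem₀).comp (hj.mono inter_subset_left) inter_subset_right
  have hf : ContDiffOn ℝ ∞ (φ₀ ∘ j) V₁ := contMDiffOn_iff_contDiffOn.1 hfm
  have hder : Function.Injective (fderiv ℝ (φ₀ ∘ j) 0) := by
    have hjd : MDifferentiableAt (𝓡 r) (𝓡 n) j 0 :=
      (hj.contMDiffAt (hV.mem_nhds h0)).mdifferentiableAt (by simp)
    have hφd := mdifferentiable_of_mem_maximalAtlas hmem₀
    have h1 := mfderiv_comp (0 : EuclideanSpace ℝ (Fin r)) (hφd.mdifferentiableAt h0V₁.2) hjd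
    rw [← mfderiv_eq_fderiv, h1]
    exact (hφd.mfderiv_injective h0V₁.2).comp himm
  obtain ⟨ψ, B, hBinj, h0ψ, hψ, hψs, hψB⟩ :=
    exists_openPartialHomeomorph_comp_eq hV₁o h0V₁ hf hder
  have h0t : B 0 ∈ (φ₀ ≫ₕ ψ.symm).target := by
    rw [OpenPartialHomeomorph.trans_target]
    refine ⟨by simpa using h0ψ, ?_⟩
    change ψ (B 0) ∈ φ₀.target
    rw [hψB]
    exact φ₀.map_source h0V₁.2
  refine ⟨φ₀ ≫ₕ ψ.symm, ?_, B, hBinj, V₁ ∩ B ⁻¹' (φ₀ ≫ₕ ψ.symm).target,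
    hV₁o.inter ((φ₀ ≫ₕ ψ.symm).open_target.preimage B.continuous), ⟨h0V₁, h0t⟩,
    fun y hy => hy.1.1, fun y hy => ⟨hy.2, ?_⟩⟩
  · refine OpenPartialHomeomorph.mem_maximalAtlas_of_contMDiffOn _ ?_ ?_
    · exact (contMDiffOn_iff_contDiffOn.2 hψs).comp
        ((contMDiffOn_of_mem_maximalAtlas hmem₀).mono fun x hx => hx.1) fun x hx => hx.2
    · exact (contMDiffOn_symm_of_mem_maximalAtlas hmem₀).comp
        ((contMDiffOn_iff_contDiffOn.2 hψ).mono fun x hx => hx.1) fun x hx => hx.2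
  · change φ₀.symm (ψ (B y)) = j y
    rw [hψB]
    exact φ₀.left_inv hy.1.2

end AdaptedChart


/-! ### Composition and uniform convergence of derivatives -/

section Composition

open Set Filter

variable {A B C : Type*} [NormedAddCommGroup A] [NormedSpace ℝ A] [NormedAddCommGroup B]
  [NormedSpace ℝ B] [NormedAddCommGroup C] [NormedSpace ℝ C]

variable (A B) in
/-- Jets of order `s`, without the value. -/
abbrev JetSpace (s : ℕ) : Type _ := (i : Fin (s + 1)) → A [×(i : ℕ)]→L[ℝ] B

/-- A jet of order `s` as a formal multilinear series. -/
def JetSpace.toSeries {s : ℕ} (p : JetSpace A B s) : FormalMultilinearSeries ℝ A B :=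
  fun m => if h : m < s + 1 then p ⟨m, h⟩ else 0

theorem JetSpace.continuous_toSeries_apply (s m : ℕ) :
    Continuous fun p : JetSpace A B s => p.toSeries m := by
  by_cases h : m < s + 1
  · simp only [toSeries, h, dif_pos]
    exact continuous_apply (⟨m, h⟩ : Fin (s + 1))
  · simp only [toSeries, h, dif_neg, not_false_eq_true]
    exact continuous_const

/-- The `s`-jet of a function. -/
def jet (s : ℕ) (u : A → B) (x : A) : B × JetSpace A B s :=
  (u x, fun i => iteratedFDeriv ℝ i u x)

/-- The action of `Ψ` on `s`-jets of functions. -/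
def jetComp (Ψ : B → C) (s : ℕ) (z : B × JetSpace A B s) : JetSpace A C s :=
  fun j => (ftaylorSeries ℝ Ψ z.1).taylorComp z.2.toSeries j

/-- Faà di Bruno's formula: at a point, derivatives of `Ψ ∘ u` up to order `s` depend only on the
`s`-jet of `u`. -/
theorem iteratedFDeriv_comp_eq_jetComp {Ψ : B → C} {u : A → B} {x : A}
    (hΨ : ContDiffAt ℝ ∞ Ψ (u x)) (hu : ContDiffAt ℝ ∞ u x) {s : ℕ} (j : Fin (s + 1)) :
    iteratedFDeriv ℝ j (Ψ ∘ u) x = jetComp Ψ s (jet s u x) j := by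
  rw [iteratedFDeriv_comp hΨ hu (i := j) (by exact_mod_cast le_top)]
  refine Finset.sum_congr rfl fun c _ => ?_
  simp only [FormalMultilinearSeries.compAlongOrderedFinpartition]
  congr 1
  funext m
  -- The parts of a partition of `j ≤ s` have size at most `s`, so the zero coefficients above order
  -- `s` never enter.
  have h : c.partSize m < s + 1 := (c.partSize_le m).trans_lt j.2
  simp [jet, JetSpace.toSeries, h, ftaylorSeries]

theorem continuousAt_jetComp {Ψ : B → C} {s : ℕ} {z : B × JetSpace A B s}
    (hΨ : ContDiffAt ℝ ∞ Ψ z.1) : ContinuousAt (jetComp Ψ s) z := by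
  refine continuousAt_pi.2 fun j => ?_
  change ContinuousAt (fun z : B × JetSpace A B s => ∑ c : OrderedFinpartition j,
    c.compAlongOrderedFinpartitionL ℝ A B C (iteratedFDeriv ℝ c.length Ψ z.1)
      (fun m => z.2.toSeries (c.partSize m))) z
  refine tendsto_finsetSum _ fun c _ => ?_
  have h1 : ContinuousAt (fun z : B × JetSpace A B s =>
      c.compAlongOrderedFinpartitionL ℝ A B C (iteratedFDeriv ℝ c.length Ψ z.1)) z :=
    (c.compAlongOrderedFinpartitionL ℝ A B C).continuous.continuousAt.comp
      ((hΨ.continuousAt_iteratedFDeriv (by exact_mod_cast le_top)).comp continuousAt_fst)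
  have h2 : ContinuousAt (fun z : B × JetSpace A B s =>
      fun m => z.2.toSeries (c.partSize m)) z :=
    continuousAt_pi.2 fun m =>
      ((JetSpace.continuous_toSeries_apply s _).comp continuous_snd).continuousAt
  exact h1.eval h2

/-- Composition with a smooth map on the left is continuous for uniform convergence of
derivatives on a compact set. -/
theorem exists_forall_iteratedFDeriv_comp_sub_lt {Ψ : B → C} {O : Set B} (hO : IsOpen O)
    (hΨ : ∀ z ∈ O, ContDiffAt ℝ ∞ Ψ z) {K : Set A} (hK : IsCompact K) {u : A → B}
    (hu : ∀ x ∈ K, ContDiffAt ℝ ∞ u x) (hKO : ∀ x ∈ K, u x ∈ O) (s : ℕ) {ε : ℝ} (hε : 0 < ε) :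
    ∃ δ > 0, ∀ u' : A → B, (∀ x ∈ K, ContDiffAt ℝ ∞ u' x) →
      (∀ x ∈ K, ∀ j ≤ s, ‖iteratedFDeriv ℝ j u' x - iteratedFDeriv ℝ j u x‖ < δ) →
      (∀ x ∈ K, u' x ∈ O) ∧ ∀ x ∈ K, ∀ j ≤ s,
        ‖iteratedFDeriv ℝ j (Ψ ∘ u') x - iteratedFDeriv ℝ j (Ψ ∘ u) x‖ < ε := by
  have hjet : ContinuousOn (jet s u) K := by
    intro x hx
    refine ContinuousAt.continuousWithinAt ((hu x hx).continuousAt.prodMk (continuousAt_pi.2 ?_))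
    exact fun i => (hu x hx).continuousAt_iteratedFDeriv (by exact_mod_cast le_top)
  have huc : ContinuousOn u K := fun x hx => (hu x hx).continuousAt.continuousWithinAt
  obtain ⟨δ₁, hδ₁, hthick⟩ := (hK.image_of_continuousOn huc).exists_thickening_subset_open hO
    (image_subset_iff.2 hKO)
  -- Uniformity is needed between points of the compact set of jets of `u` and arbitrary nearby
  -- jets, since those of `u'` need not lie in that set.
  have hunif := (hK.image_of_continuousOn hjet).uniformContinuousAt_of_continuousAt
    (jetComp (A := A) Ψ s) (by
      rintro _ ⟨x, hx, rfl⟩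
      exact continuousAt_jetComp (hΨ _ (hKO x hx))) (Metric.dist_mem_uniformity hε)
  obtain ⟨δ₂, hδ₂, hδ₂'⟩ := Metric.mem_uniformity_dist.1 hunif
  refine ⟨min δ₁ δ₂, lt_min hδ₁ hδ₂, fun u' hu' hclose => ?_⟩
  have hval : ∀ x ∈ K, dist (u' x) (u x) < min δ₁ δ₂ := fun x hx => by
    have h1 := hclose x hx 0 (Nat.zero_le _)
    have h2 : ‖(iteratedFDeriv ℝ 0 u' x - iteratedFDeriv ℝ 0 u x) ![]‖ ≤
        ‖iteratedFDeriv ℝ 0 u' x - iteratedFDeriv ℝ 0 u x‖ := by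
      simpa using (iteratedFDeriv ℝ 0 u' x - iteratedFDeriv ℝ 0 u x).le_opNorm ![]
    rw [dist_eq_norm]
    simpa using h2.trans_lt h1
  have hO' : ∀ x ∈ K, u' x ∈ O := fun x hx => hthick <| Metric.mem_thickening_iff.2
    ⟨u x, mem_image_of_mem u hx, (hval x hx).trans_le (min_le_left _ _)⟩
  refine ⟨hO', fun x hx j hj => ?_⟩
  have hd : dist (jet s u x) (jet s u' x) < δ₂ := by
    rw [Prod.dist_eq, max_lt_iff]
    refine ⟨?_, (dist_pi_lt_iff hδ₂).2 fun i => ?_⟩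
    · rw [dist_comm]
      exact (hval x hx).trans_le (min_le_right _ _)
    · rw [dist_comm, dist_eq_norm]
      exact (hclose x hx i (Nat.lt_succ_iff.1 i.2)).trans_le (min_le_right _ _)
  have h3 := (dist_pi_lt_iff hε).1 (hδ₂' hd (mem_image_of_mem _ hx)) ⟨j, Nat.lt_succ_iff.2 hj⟩
  dsimp only at h3
  rw [← iteratedFDeriv_comp_eq_jetComp (hΨ _ (hKO x hx)) (hu x hx),
    ← iteratedFDeriv_comp_eq_jetComp (hΨ _ (hO' x hx)) (hu' x hx), dist_comm, dist_eq_norm] at h3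
  exact h3

/-- Bound for the difference of the derivatives of two finite families of functions composed with
a linear map. -/
theorem norm_iteratedFDeriv_pi_comp_sub_le {r : ℕ} {e e' : Fin r → B → C} (ℓ : A →L[ℝ] B)
    {V : Set B} (hV : IsOpen V) (he : ∀ i, ContDiffOn ℝ ∞ (e i) V)
    (he' : ∀ i, ContDiffOn ℝ ∞ (e' i) V) {y : A} (hy : ℓ y ∈ V) {j : ℕ} {δ : ℝ} (hδ : 0 ≤ δ)
    (hclose : ∀ i, ‖iteratedFDeriv ℝ j (e' i) (ℓ y) - iteratedFDeriv ℝ j (e i) (ℓ y)‖ ≤ δ) :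
    ‖iteratedFDeriv ℝ j (fun y i => e' i (ℓ y)) y - iteratedFDeriv ℝ j (fun y i => e i (ℓ y)) y‖
      ≤ δ * ‖ℓ‖ ^ j := by
  have hcomp : ∀ f : B → C, ContDiffOn ℝ ∞ f V → iteratedFDeriv ℝ j (f ∘ ℓ) y =
      (iteratedFDeriv ℝ j f (ℓ y)).compContinuousLinearMap fun _ => ℓ := fun f hf => by
    have h := ℓ.iteratedFDerivWithin_comp_right hf hV.uniqueDiffOn
      (hV.preimage ℓ.continuous).uniqueDiffOn hy (i := j) (by exact_mod_cast le_top)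
    rwa [iteratedFDerivWithin_of_isOpen _ hV hy,
      iteratedFDerivWithin_of_isOpen _ (hV.preimage ℓ.continuous) hy] at h
  have hproj : ∀ f : Fin r → B → C, (∀ i, ContDiffOn ℝ ∞ (f i) V) → ∀ (m : Fin j → A) (i : Fin r),
      iteratedFDeriv ℝ j (fun y i => f i (ℓ y)) y m i =
        iteratedFDeriv ℝ j (f i) (ℓ y) fun k => ℓ (m k) := fun f hf m i => by
    have h1 : ContDiffAt ℝ ∞ (fun y i => f i (ℓ y)) y := contDiffAt_pi.2 fun i =>
      ((hf i).contDiffAt (hV.mem_nhds hy)).comp y ℓ.contDiff.contDiffAt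
    have h2 := (ContinuousLinearMap.proj (R := ℝ) (φ := fun _ : Fin r => C) i).iteratedFDeriv_comp_left
      h1 (i := j) (by exact_mod_cast le_top)
    have h3 := hcomp (f i) (hf i)
    exact (DFunLike.congr_fun h2 m).symm.trans (DFunLike.congr_fun h3 m)
  refine ContinuousMultilinearMap.opNorm_le_bound (by positivity) fun m => ?_
  refine (pi_norm_le_iff_of_nonneg (by positivity)).2 fun i => ?_
  have h4 : (iteratedFDeriv ℝ j (fun y i => e' i (ℓ y)) y -
      iteratedFDeriv ℝ j (fun y i => e i (ℓ y)) y) m i =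
      (iteratedFDeriv ℝ j (e' i) (ℓ y) - iteratedFDeriv ℝ j (e i) (ℓ y)) fun k => ℓ (m k) := by
    rw [sub_apply, sub_apply, Pi.sub_apply,
      hproj e' he', hproj e he]
  rw [h4]
  calc _ ≤ ‖iteratedFDeriv ℝ j (e' i) (ℓ y) - iteratedFDeriv ℝ j (e i) (ℓ y)‖ *
        ∏ k, ‖ℓ (m k)‖ := ContinuousMultilinearMap.le_opNorm _ _
    _ ≤ δ * ∏ k, (‖ℓ‖ * ‖m k‖) := by
        gcongr with k
        · exact hclose i
        · exact ℓ.le_opNorm _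
    _ = δ * ‖ℓ‖ ^ j * ∏ k, ‖m k‖ := by
        rw [Finset.prod_mul_distrib, Finset.prod_const, Finset.card_univ, Fintype.card_fin]
        ring

end Composition


/-! ### The Poisson structure induced on a linear transversal -/

section Transversal

open Set Filter Module

variable {E G Z : Type*} [NormedAddCommGroup E] [NormedSpace ℝ E] [NormedAddCommGroup G]
  [NormedSpace ℝ G] [NormedAddCommGroup Z] [NormedSpace ℝ Z]

/-- The maps `ℓ : G → E` and `p : E → Z` form a split short exact sequence, with retraction `a`
of `ℓ`. -/
structure IsSplitSequence (ℓ : G →L[ℝ] E) (a : E →L[ℝ] G) (p : E →L[ℝ] Z) : Prop where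
  left_inv : ∀ y, a (ℓ y) = y
  comp_apply : ∀ y, p (ℓ y) = 0
  apply_eq : ∀ v, p v = 0 → ℓ (a v) = v
  finrank_add : finrank ℝ Z + finrank ℝ G = finrank ℝ E

theorem exists_isSplitSequence [FiniteDimensional ℝ E] {ℓ : G →L[ℝ] E}
    (hℓ : Function.Injective ℓ) :
    ∃ (a : E →L[ℝ] G) (p : E →L[ℝ] (Fin (finrank ℝ E - finrank ℝ G) → ℝ)),
      IsSplitSequence ℓ a p := by
  have : FiniteDimensional ℝ G := FiniteDimensional.of_injective (ℓ : G →ₗ[ℝ] E) hℓ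
  obtain ⟨a, ha⟩ := LinearMap.exists_leftInverse_of_injective (ℓ : G →ₗ[ℝ] E)
    (LinearMap.ker_eq_bot.2 hℓ)
  set R := LinearMap.range (ℓ : G →ₗ[ℝ] E) with hR
  have hdim : finrank ℝ R = finrank ℝ G := LinearMap.finrank_range_of_inj hℓ
  have hle : finrank ℝ G ≤ finrank ℝ E := LinearMap.finrank_le_finrank_of_injective hℓ
  have hq : finrank ℝ (E ⧸ R) = finrank ℝ (Fin (finrank ℝ E - finrank ℝ G) → ℝ) := by
    have := R.finrank_quotient_add_finrank
    rw [finrank_fin_fun]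
    omega
  have hla : ∀ y, a (ℓ y) = y := fun y => LinearMap.congr_fun ha y
  refine ⟨LinearMap.toContinuousLinearMap a, LinearMap.toContinuousLinearMap
    ((LinearEquiv.ofFinrankEq _ _ hq).toLinearMap.comp R.mkQ), hla, fun y => ?_, fun v hv => ?_, ?_⟩
  · have h : R.mkQ (ℓ y) = 0 := (Submodule.Quotient.mk_eq_zero R).2 ⟨y, rfl⟩
    change (LinearEquiv.ofFinrankEq _ _ hq) (R.mkQ (ℓ y)) = 0
    rw [h, map_zero]
  · have h : (LinearEquiv.ofFinrankEq _ _ hq) (R.mkQ v) = 0 := hv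
    rw [LinearEquiv.map_eq_zero_iff] at h
    obtain ⟨y, rfl⟩ := (Submodule.Quotient.mk_eq_zero R).1 h
    exact congrArg ℓ (hla y)
  · rw [finrank_fin_fun]
    omega

/-- The map `(X, ξ) ↦ (p X, ξ ∘ ℓ)`. -/
def transverseMap (ℓ : G →L[ℝ] E) (p : E →L[ℝ] Z) : E × (E →L[ℝ] ℝ) →L[ℝ] Z × (G →L[ℝ] ℝ) :=
  (p.comp (ContinuousLinearMap.fst ℝ E (E →L[ℝ] ℝ))).prod
    (((ContinuousLinearMap.compL ℝ G E ℝ).flip ℓ).comp (ContinuousLinearMap.snd ℝ E (E →L[ℝ] ℝ)))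

@[simp]
theorem transverseMap_apply (ℓ : G →L[ℝ] E) (p : E →L[ℝ] Z) (u : E × (E →L[ℝ] ℝ)) :
    transverseMap ℓ p u = (p u.1, u.2.comp ℓ) :=
  rfl

/-- The target of `transverseMap` has the rank of a Dirac structure, so injectivity on a fibre
already gives an isomorphism. -/
theorem finrank_prod_dual [FiniteDimensional ℝ E] [FiniteDimensional ℝ G] [FiniteDimensional ℝ Z]
    {ℓ : G →L[ℝ] E} {a : E →L[ℝ] G} {p : E →L[ℝ] Z}
    (h : IsSplitSequence ℓ a p) : finrank ℝ (Z × (G →L[ℝ] ℝ)) = finrank ℝ E := by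
  have h1 : finrank ℝ (G →L[ℝ] ℝ) = finrank ℝ G :=
    (LinearEquiv.finrank_eq (LinearMap.toContinuousLinearMap (E := G) (F' := ℝ))).symm.trans
      (Subspace.dual_finrank_eq (K := ℝ) (V := G))
  rw [finrank_prod, h1, h.finrank_add]

/-- The bivector induced on the image of `ℓ` by a normalized frame for `transverseMap ℓ p`. -/
def transverseBivector (ℓ : G →L[ℝ] E) (a : E →L[ℝ] G)
    (σ : E → Z × (G →L[ℝ] ℝ) →L[ℝ] E × (E →L[ℝ] ℝ)) (y : G) : (G →L[ℝ] ℝ) →L[ℝ] G :=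
  (a.comp (ContinuousLinearMap.fst ℝ E (E →L[ℝ] ℝ))).comp
    ((σ (ℓ y)).comp (ContinuousLinearMap.inr ℝ Z (G →L[ℝ] ℝ)))

variable {ℓ : G →L[ℝ] E} {a : E →L[ℝ] G} {p : E →L[ℝ] Z}
  {σ : E → Z × (G →L[ℝ] ℝ) →L[ℝ] E × (E →L[ℝ] ℝ)} {D : E → Submodule ℝ (E × (E →L[ℝ] ℝ))}
  {U V : Set E}

theorem snd_comp_eq (hσ : IsNormalizedFrameOn (transverseMap ℓ p) D V σ) {x : E} (hx : x ∈ V)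
    (α : G →L[ℝ] ℝ) (v : G) : (σ x (0, α)).2 (ℓ v) = α v :=
  DFunLike.congr_fun (congrArg Prod.snd (hσ.map_apply hx (0, α))) v

theorem fst_apply_eq (hs : IsSplitSequence ℓ a p)
    (hσ : IsNormalizedFrameOn (transverseMap ℓ p) D V σ) {y : G} (hy : ℓ y ∈ V) (α : G →L[ℝ] ℝ) :
    (σ (ℓ y) (0, α)).1 = ℓ (transverseBivector ℓ a σ y α) :=
  (hs.apply_eq _ (congrArg Prod.fst (hσ.map_apply hy (0, α)))).symm

theorem fst_fderiv_apply_eq (hs : IsSplitSequence ℓ a p)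
    (hσ : IsNormalizedFrameOn (transverseMap ℓ p) D V σ) {x : E} (hx : x ∈ V) (v : E)
    (w : Z × (G →L[ℝ] ℝ)) : (fderiv ℝ σ x v w).1 = ℓ (a (fderiv ℝ σ x v w).1) :=
  (hs.apply_eq _ (congrArg Prod.fst (hσ.map_fderiv_apply hx v w))).symm

theorem snd_fderiv_apply_eq (hσ : IsNormalizedFrameOn (transverseMap ℓ p) D V σ) {x : E}
    (hx : x ∈ V) (v : E) (w : Z × (G →L[ℝ] ℝ)) (y : G) : (fderiv ℝ σ x v w).2 (ℓ y) = 0 :=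
  DFunLike.congr_fun (congrArg Prod.snd (hσ.map_fderiv_apply hx v w)) y

theorem contDiffOn_transverseBivector (hσ : IsNormalizedFrameOn (transverseMap ℓ p) D V σ) :
    ContDiffOn ℝ ∞ (transverseBivector ℓ a σ) (ℓ ⁻¹' V) :=
  contDiffOn_const.clm_comp
    ((hσ.smooth.comp ℓ.contDiff.contDiffOn fun _ hy => hy).clm_comp contDiffOn_const)

theorem fderiv_transverseBivector_apply (hσ : IsNormalizedFrameOn (transverseMap ℓ p) D V σ)
    {y : G} (hy : ℓ y ∈ V) (v : G) (α : G →L[ℝ] ℝ) :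
    fderiv ℝ (transverseBivector ℓ a σ) y v α = a (fderiv ℝ σ (ℓ y) (ℓ v) (0, α)).1 := by
  have h1 : HasFDerivAt (fun y => σ (ℓ y)) ((fderiv ℝ σ (ℓ y)).comp ℓ) y :=
    (hσ.hasFDerivAt hy).comp y ℓ.hasFDerivAt
  have h2 := (hasFDerivAt_const (a.comp (ContinuousLinearMap.fst ℝ E (E →L[ℝ] ℝ))) y).clm_comp
    (h1.clm_comp (hasFDerivAt_const (ContinuousLinearMap.inr ℝ Z (G →L[ℝ] ℝ)) y))
  have h3 : fderiv ℝ (transverseBivector ℓ a σ) y = _ := h2.fderiv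
  rw [h3]
  simp

theorem IsDiracOn.isotropic_apply (hD : IsDiracOn U D) {x : E} (hx : x ∈ U)
    {u v : E × (E →L[ℝ] ℝ)} (hu : u ∈ D x) (hv : v ∈ D x) : u.2 v.1 + v.2 u.1 = 0 := by
  have := hD.isotropic x hx u hu v hv
  linarith

theorem transverseBivector_skew (hs : IsSplitSequence ℓ a p) (hD : IsDiracOn U D)
    (hσ : IsNormalizedFrameOn (transverseMap ℓ p) D V σ) (hVU : V ⊆ U) {y : G} (hy : ℓ y ∈ V)
    (α β : G →L[ℝ] ℝ) :
    β (transverseBivector ℓ a σ y α) = -α (transverseBivector ℓ a σ y β) := by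
  have h := hD.isotropic_apply (hVU hy) (hσ.apply_mem hy (0, α)) (hσ.apply_mem hy (0, β))
  rw [fst_apply_eq hs hσ hy, fst_apply_eq hs hσ hy, snd_comp_eq hσ hy, snd_comp_eq hσ hy] at h
  linarith

theorem fderiv_transverseBivector_skew (hs : IsSplitSequence ℓ a p) (hD : IsDiracOn U D)
    (hσ : IsNormalizedFrameOn (transverseMap ℓ p) D V σ) (hVU : V ⊆ U) {y : G} (hy : ℓ y ∈ V)
    (v : G) (α β : G →L[ℝ] ℝ) :
    β (fderiv ℝ (transverseBivector ℓ a σ) y v α) =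
      -α (fderiv ℝ (transverseBivector ℓ a σ) y v β) := by
  have hopen : IsOpen (ℓ ⁻¹' V) := hσ.isOpen.preimage ℓ.continuous
  have hd : HasFDerivAt (transverseBivector ℓ a σ) _ y :=
    (((contDiffOn_transverseBivector hσ).contDiffAt (hopen.mem_nhds hy)).differentiableAt
      (by simp)).hasFDerivAt
  have h1 : ∀ α β : G →L[ℝ] ℝ, HasFDerivAt (fun z => β (transverseBivector ℓ a σ z α))
      (β.comp ((fderiv ℝ (transverseBivector ℓ a σ) y).flip α)) y := fun α β =>
    β.hasFDerivAt.comp y ((hd.clm_apply (hasFDerivAt_const α y)).congr_fderiv (by ext; simp))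
  have h2 : (fun z => β (transverseBivector ℓ a σ z α)) =ᶠ[𝓝 y]
      fun z => -α (transverseBivector ℓ a σ z β) := by
    filter_upwards [hopen.mem_nhds hy] with z hz
      using transverseBivector_skew hs hD hσ hVU hz α β
  exact DFunLike.congr_fun ((h1 α β).unique ((h1 β α).neg.congr_of_eventuallyEq h2)) v

/-- The Jacobi identity for the induced bivector. -/
theorem transverseBivector_jacobi (hs : IsSplitSequence ℓ a p) (hD : IsDiracOn U D)
    (hσ : IsNormalizedFrameOn (transverseMap ℓ p) D V σ) (hVU : V ⊆ U) {y : G} (hy : ℓ y ∈ V)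
    (α β γ : G →L[ℝ] ℝ) :
    let π := transverseBivector ℓ a σ
    γ (fderiv ℝ π y (π y α) β) + α (fderiv ℝ π y (π y β) γ) + β (fderiv ℝ π y (π y γ) α) = 0 := by
  intro π
  have hsm : ∀ w, ContDiffOn ℝ ∞ (fun x => σ x w) V := fun w =>
    hσ.smooth.clm_apply contDiffOn_const
  have hmem : courantBracket (fun x => σ x (0, α)) (fun x => σ x (0, β)) (ℓ y) ∈ D (ℓ y) :=
    hD.involutive V hσ.isOpen hVU _ _ (hsm _) (hsm _) (fun x hx => hσ.apply_mem hx _)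
      (fun x hx => hσ.apply_mem hx _) _ hy
  have hder : HasFDerivAt (fun x => σ x (0, α)) ((fderiv ℝ σ (ℓ y)).flip (0, α)) (ℓ y) :=
    ((hσ.hasFDerivAt hy).clm_apply (hasFDerivAt_const (0, α) (ℓ y))).congr_fderiv (by
      ext v <;> simp)
  rw [courantBracket_const_apply hder.differentiableAt (hσ.hasFDerivAt hy).differentiableAt,
    hder.fderiv] at hmem
  -- The Jacobi identity is the vanishing of the pairing of the bracket of the lifts of `α` and `β`
  -- with the lift of `γ`. Derivatives of `σ` have vector part tangent to the transversal and
  -- covector part vanishing on it, so only derivatives of the bivector survive.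
  have h := hD.isotropic_apply (hVU hy) hmem (hσ.apply_mem hy (0, γ))
  have hfst := fst_apply_eq hs hσ hy
  have hD1 : ∀ v w (δ : G →L[ℝ] ℝ), (σ (ℓ y) (0, δ)).2 (fderiv ℝ σ (ℓ y) v (0, w)).1 =
      δ (a (fderiv ℝ σ (ℓ y) v (0, w)).1) := fun v w δ => by
    conv_lhs => rw [fst_fderiv_apply_eq hs hσ hy v (0, w)]
    exact snd_comp_eq hσ hy δ _
  have hD2 := fun v w z => snd_fderiv_apply_eq hσ hy v (0, w) z
  have hπ := fun v w => fderiv_transverseBivector_apply (a := a) hσ hy v w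
  simp only [courantOperator, Prod.fst_add, Prod.snd_add, add_apply, sub_apply, neg_apply,
    ContinuousLinearMap.comp_apply, ContinuousLinearMap.inl_apply, ContinuousLinearMap.inr_apply,
    ContinuousLinearMap.coe_fst', ContinuousLinearMap.coe_snd', ContinuousLinearMap.flip_apply,
    ContinuousLinearMap.compL_apply, add_zero, zero_add, hfst, map_add, map_neg, Prod.fst_neg,
    Prod.snd_neg, neg_zero, hD1, hD2, ← hπ] at h
  -- The pairing produces one cyclic term as `-γ (Dπ (π β) α)`; skewness of the derivative rewrites
  -- it as `α (Dπ (π β) γ)`.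
  have hskew := fderiv_transverseBivector_skew hs hD hσ hVU hy (π y β) α γ
  linarith

/-- The induced bivector as a Poisson structure. -/
def transverseBivectorField (hs : IsSplitSequence ℓ a p) (hD : IsDiracOn U D)
    (hσ : IsNormalizedFrameOn (transverseMap ℓ p) D V σ) (hVU : V ⊆ U) {N : Set G}
    (hN : ∀ y ∈ N, ℓ y ∈ V) : BivectorField N where
  toFun := transverseBivector ℓ a σ
  smooth := (contDiffOn_transverseBivector hσ).mono hN
  skew y hy α β := transverseBivector_skew hs hD hσ hVU (hN y hy) α β

theorem transverseBivectorField_isPoisson (hs : IsSplitSequence ℓ a p) (hD : IsDiracOn U D)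
    (hσ : IsNormalizedFrameOn (transverseMap ℓ p) D V σ) (hVU : V ⊆ U) {N : Set G}
    (hN : ∀ y ∈ N, ℓ y ∈ V) : (transverseBivectorField hs hD hσ hVU hN).IsPoisson :=
  fun y hy α β γ => transverseBivector_jacobi hs hD hσ hVU (hN y hy) α β γ

/-- The graph of the induced bivector is the backward image under `ℓ`. -/
theorem transverseBivector_apply_of_mem (hs : IsSplitSequence ℓ a p)
    (hσ : IsNormalizedFrameOn (transverseMap ℓ p) D V σ) {y : G} (hy : ℓ y ∈ V) (α : G →L[ℝ] ℝ) :
    ∃ η : E →L[ℝ] ℝ, (ℓ (transverseBivector ℓ a σ y α), η) ∈ D (ℓ y) ∧ α = η.comp ℓ := by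
  refine ⟨(σ (ℓ y) (0, α)).2, ?_, ?_⟩
  · rw [← fst_apply_eq hs hσ hy]
    exact hσ.apply_mem hy _
  · ext v
    exact (snd_comp_eq hσ hy α v).symm

/-- At a zero of the induced bivector, the characteristic distribution is a complement of the
transversal. -/
theorem finrank_map_fst_of_transverseBivector_eq_zero (hs : IsSplitSequence ℓ a p)
    (hσ : IsNormalizedFrameOn (transverseMap ℓ p) D V σ) {y : G} (hy : ℓ y ∈ V)
    (h0 : transverseBivector ℓ a σ y = 0) :
    finrank ℝ ((D (ℓ y)).map (LinearMap.fst ℝ E (E →L[ℝ] ℝ))) = finrank ℝ Z := by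
  refine LinearEquiv.finrank_eq (LinearEquiv.ofBijective
    ((p : E →ₗ[ℝ] Z).comp ((D (ℓ y)).map (LinearMap.fst ℝ E (E →L[ℝ] ℝ))).subtype) ⟨?_, ?_⟩)
  · rw [injective_iff_map_eq_zero]
    rintro ⟨_, ⟨⟨X, ξ⟩, hX, rfl⟩⟩ hpX
    have hpX' : p X = 0 := hpX
    -- `p` maps the characteristic distribution isomorphically onto `Z`. If `p X = 0`, then `(X, ξ)`
    -- is the lift of `(0, ξ ∘ ℓ)`, so `X` is the image under `ℓ` of a value of the bivector, which
    -- is zero; the lifts of `(z, 0)` give surjectivity.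
    have h1 := hσ.apply_eq hy hX
    rw [transverseMap_apply, hpX'] at h1
    have h2 := fst_apply_eq hs hσ hy (ξ.comp ℓ)
    rw [h1, h0] at h2
    exact Subtype.ext (by simpa using h2)
  · intro z
    exact ⟨⟨_, _, hσ.apply_mem hy (z, 0), rfl⟩, congrArg Prod.fst (hσ.map_apply hy (z, 0))⟩

/-- A frame is regular for `transverseMap ℓ p` at a point where the characteristic distribution
and the transversal span the tangent space, and where the backward image is a graph. -/
theorem mem_regularFrames_transverseMap [FiniteDimensional ℝ E] [FiniteDimensional ℝ G]
    [FiniteDimensional ℝ Z] (hs : IsSplitSequence ℓ a p) (hD : IsDiracOn U D) {x : E} (hx : x ∈ U)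
    (hspan : (D x).map (LinearMap.fst ℝ E (E →L[ℝ] ℝ)) ⊔ LinearMap.range (ℓ : G →ₗ[ℝ] E) = ⊤)
    (hgraph : ∀ v (η : E →L[ℝ] ℝ), (ℓ v, η) ∈ D x → η.comp ℓ = 0 → v = 0)
    {m : ℕ} (hm : finrank ℝ E = m) {e : Fin m → E × (E →L[ℝ] ℝ)}
    (he : Submodule.span ℝ (range e) = D x) : e ∈ regularFrames (transverseMap ℓ p) m := by
  refine mem_regularFrames he ((hD.rank x hx).trans hm) ((finrank_prod_dual hs).trans hm) ?_
  rintro ⟨X, ξ⟩ hX hq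
  have hp : p X = 0 := congrArg Prod.fst hq
  have hξ : ξ.comp ℓ = 0 := congrArg Prod.snd hq
  have hX0 : X = 0 := by
    have h1 := hs.apply_eq X hp
    rw [← h1] at hX
    rw [← h1, hgraph _ _ hX hξ, map_zero]
  subst hX0
  -- By isotropy against `(0, ξ)`, `ξ` annihilates the characteristic distribution; it also vanishes
  -- on the transversal, and the two span.
  have hle : (⊤ : Submodule ℝ E) ≤ LinearMap.ker (ξ : E →ₗ[ℝ] ℝ) := by
    rw [← hspan, sup_le_iff]
    constructor
    · rintro _ ⟨⟨Y, η⟩, hY, rfl⟩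
      have := hD.isotropic_apply hx hX hY
      simpa using this
    · rintro _ ⟨v, rfl⟩
      exact DFunLike.congr_fun hξ v
  have hξ0 : ξ = 0 := by
    ext v
    exact hle (Submodule.mem_top (x := v))
  rw [hξ0]
  rfl

end Transversal


/-! ### Neighbourhoods of bivector fields -/

section BivectorNeighbourhoods

open Set Filter

/-- Compact subsets are directed under union, so a single compact set and a single `ε` describe a
basic neighbourhood. -/
theorem exists_forall_norm_sub_lt_of_mem_nhds {A B : Type*} [TopologicalSpace A]
    [NormedAddCommGroup B] {V : Set A} {f : A → B}
    {t : Set (UniformOnFun A B {K : Set A | IsCompact K ∧ K ⊆ V})}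
    (ht : t ∈ 𝓝 (UniformOnFun.ofFun {K : Set A | IsCompact K ∧ K ⊆ V} f)) :
    ∃ (K : Set A) (ε : ℝ), (IsCompact K ∧ K ⊆ V) ∧ 0 < ε ∧
      ∀ g : A → B, (∀ x ∈ K, ‖g x - f x‖ < ε) → UniformOnFun.ofFun _ g ∈ t := by
  have hne : {K : Set A | IsCompact K ∧ K ⊆ V}.Nonempty :=
    ⟨∅, isCompact_empty, empty_subset _⟩
  have hdir : DirectedOn (· ⊆ ·) {K : Set A | IsCompact K ∧ K ⊆ V} := fun K₁ h₁ K₂ h₂ =>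
    ⟨K₁ ∪ K₂, ⟨h₁.1.union h₂.1, union_subset h₁.2 h₂.2⟩, subset_union_left, subset_union_right⟩
  obtain ⟨⟨K, ε⟩, ⟨hK, hε⟩, hsub⟩ := (UniformOnFun.hasBasis_nhds_of_basis A B _ _ hne hdir
    Metric.uniformity_basis_dist).mem_iff.1 ht
  refine ⟨K, ε, hK, hε, fun g hg => hsub fun x hx => ?_⟩
  have h1 := hg x hx
  rwa [← dist_eq_norm] at h1

variable {F : Type*} [NormedAddCommGroup F] [NormedSpace ℝ F]

theorem exists_isCompact_of_mem_nhds_csTopology {s : ℕ} {V : Set F} {π : BivectorField V}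
    {W : Set (BivectorField V)} (hW : W ∈ @nhds _ (BivectorField.csTopology s V) π) :
    ∃ K : Set F, IsCompact K ∧ K ⊆ V ∧ ∃ ε > 0, ∀ π' : BivectorField V,
      (∀ x ∈ K, ∀ j ≤ s, ‖iteratedFDeriv ℝ j π'.toFun x - iteratedFDeriv ℝ j π.toFun x‖ < ε) →
      π' ∈ W := by
  rw [nhds_induced, mem_comap] at hW
  obtain ⟨T, hT, hTW⟩ := hW
  rw [nhds_pi, mem_pi'] at hT
  obtain ⟨I, t, ht, htT⟩ := hT
  have hbasis := fun i => exists_forall_norm_sub_lt_of_mem_nhds (ht i)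
  choose K ε hK hε hg using hbasis
  obtain ⟨i₀, hi₀⟩ := Finite.exists_min ε
  refine ⟨⋃ i, K i, isCompact_iUnion fun i => (hK i).1, iUnion_subset fun i => (hK i).2, ε i₀,
    hε i₀, fun π' hπ' => hTW (htT fun i _ => ?_)⟩
  exact hg i _ fun x hx => (hπ' x (mem_iUnion.2 ⟨i, hx⟩) i (Nat.lt_succ_iff.1 i.2)).trans_le (hi₀ i)

end BivectorNeighbourhoods

/-! ### Linear transversals in a chart -/

section ChartTransversal

open Set Filter Module

variable {n : ℕ} {M : Type*} [TopologicalSpace M] [ChartedSpace (EuclideanSpace ℝ (Fin n)) M]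
  {r : ℕ}
  {L : (x : M) → Submodule ℝ (TangentSpace (𝓡 n) x × (TangentSpace (𝓡 n) x →L[ℝ] ℝ))}
  {φ : OpenPartialHomeomorph M (EuclideanSpace ℝ (Fin n))}
  {ℓ : EuclideanSpace ℝ (Fin r) →L[ℝ] EuclideanSpace ℝ (Fin n)}
  {j : EuclideanSpace ℝ (Fin r) → M} {y : EuclideanSpace ℝ (Fin r)}

theorem mfderiv_symm_comp_clm  [IsManifold (𝓡 n) ∞ M]
    (hφ : φ ∈ IsManifold.maximalAtlas (𝓡 n) ∞ M)
    (hy : ℓ y ∈ φ.target) :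
    mfderiv (𝓡 r) (𝓡 n) (φ.symm ∘ ℓ) y = (mfderiv (𝓡 n) (𝓡 n) φ.symm (ℓ y)).comp ℓ := by
  rw [mfderiv_comp y ((mdifferentiable_of_mem_maximalAtlas hφ).mdifferentiableAt_symm hy)
    ℓ.mdifferentiableAt, ContinuousLinearMap.mfderiv_eq]
  rfl

/-- The backward image under `φ.symm ∘ ℓ` in terms of the expression in the chart `φ`. -/
theorem mem_backwardImage_symm_comp  [IsManifold (𝓡 n) ∞ M]
    (hφ : φ ∈ IsManifold.maximalAtlas (𝓡 n) ∞ M)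
    (hy : ℓ y ∈ φ.target)
    (q : EuclideanSpace ℝ (Fin r) × (EuclideanSpace ℝ (Fin r) →L[ℝ] ℝ)) :
    q ∈ backwardImage L (φ.symm ∘ ℓ) y ↔
      ∃ η, (ℓ q.1, η) ∈ inChart L φ (ℓ y) ∧ q.2 = η.comp ℓ := by
  have h := mfderiv_symm_comp_clm hφ hy
  change (∃ ξ : TangentSpace (𝓡 n) (φ.symm (ℓ y)) →L[ℝ] ℝ,
    (mfderiv (𝓡 r) (𝓡 n) (φ.symm ∘ ℓ) y q.1, ξ) ∈ L (φ.symm (ℓ y)) ∧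
      q.2 = ξ.comp (mfderiv (𝓡 r) (𝓡 n) (φ.symm ∘ ℓ) y)) ↔ _
  rw [h]
  constructor
  · rintro ⟨ξ, hξ, hq⟩
    exact ⟨ξ.comp (mfderiv (𝓡 n) (𝓡 n) φ.symm (ℓ y)), mem_inChart.2 ⟨ξ, hξ, rfl⟩, hq⟩
  · rintro ⟨η, hη, hq⟩
    obtain ⟨ξ, hξ, rfl⟩ := mem_inChart.1 hη
    exact ⟨ξ, hξ, hq⟩

theorem backwardImage_congr {F : Type*} [NormedAddCommGroup F] [NormedSpace ℝ F] {f g : F → M}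
    {y : F} (h : f =ᶠ[𝓝 y] g) : backwardImage L f y = backwardImage L g y := by
  -- The base point occurs in the types of the tangent spaces, so points and derivatives are made
  -- variables before being identified.
  have key : ∀ (m m' : M) (T T' : F →L[ℝ] EuclideanSpace ℝ (Fin n)), m = m' → T = T' →
      ∀ q : F × (F →L[ℝ] ℝ),
      (∃ ξ : TangentSpace (𝓡 n) m →L[ℝ] ℝ, ((T q.1 : TangentSpace (𝓡 n) m), ξ) ∈ L m ∧
        q.2 = ξ.comp T) →
      (∃ ξ : TangentSpace (𝓡 n) m' →L[ℝ] ℝ, ((T' q.1 : TangentSpace (𝓡 n) m'), ξ) ∈ L m' ∧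
        q.2 = ξ.comp T') := by
    rintro m _ T _ rfl rfl q hq
    exact hq
  have hT : (mfderiv 𝓘(ℝ, F) (𝓡 n) f y : F →L[ℝ] EuclideanSpace ℝ (Fin n)) =
    mfderiv 𝓘(ℝ, F) (𝓡 n) g y := h.mfderiv_eq
  ext q
  exact ⟨key _ _ _ _ h.eq_of_nhds hT q, key _ _ _ _ h.eq_of_nhds.symm hT.symm q⟩

/-- Transversality, read in a chart. -/
theorem map_fst_inChart_sup_range_eq_top  [IsManifold (𝓡 n) ∞ M]
    (hφ : φ ∈ IsManifold.maximalAtlas (𝓡 n) ∞ M)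
    (hy : ℓ y ∈ φ.target) (hj : j =ᶠ[𝓝 y] φ.symm ∘ ℓ)
    (h : (L (j y)).map (LinearMap.fst ℝ _ _) ⊔
      LinearMap.range (mfderiv (𝓡 r) (𝓡 n) j y).toLinearMap = ⊤) :
    (inChart L φ (ℓ y)).map (LinearMap.fst ℝ (EuclideanSpace ℝ (Fin n))
      (EuclideanSpace ℝ (Fin n) →L[ℝ] ℝ)) ⊔
      LinearMap.range (ℓ : EuclideanSpace ℝ (Fin r) →ₗ[ℝ] EuclideanSpace ℝ (Fin n)) = ⊤ := by
  have key : ∀ (m m' : M) (T T' : EuclideanSpace ℝ (Fin r) →L[ℝ] EuclideanSpace ℝ (Fin n)),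
      m = m' → T = T' →
      (∀ v : EuclideanSpace ℝ (Fin n), ∃ (X : EuclideanSpace ℝ (Fin n))
        (ξ : TangentSpace (𝓡 n) m →L[ℝ] ℝ), ((X : TangentSpace (𝓡 n) m), ξ) ∈ L m ∧
          ∃ w, X + T w = v) →
      ∀ v : EuclideanSpace ℝ (Fin n), ∃ (X : EuclideanSpace ℝ (Fin n))
        (ξ : TangentSpace (𝓡 n) m' →L[ℝ] ℝ), ((X : TangentSpace (𝓡 n) m'), ξ) ∈ L m' ∧
          ∃ w, X + T' w = v := by
    rintro m _ T _ rfl rfl h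
    exact h
  have hT : (mfderiv (𝓡 r) (𝓡 n) j y : EuclideanSpace ℝ (Fin r) →L[ℝ] EuclideanSpace ℝ (Fin n)) =
      (mfderiv (𝓡 n) (𝓡 n) φ.symm (ℓ y) :
        EuclideanSpace ℝ (Fin n) →L[ℝ] EuclideanSpace ℝ (Fin n)).comp ℓ :=
    (Filter.EventuallyEq.mfderiv_eq hj).trans (mfderiv_symm_comp_clm hφ hy)
  have h1 := key _ _ _ _ hj.eq_of_nhds hT (fun v => by
    obtain ⟨_, ⟨q, hq, rfl⟩, _, ⟨w, rfl⟩, hqw⟩ := Submodule.mem_sup.1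
      ((Submodule.eq_top_iff'.1 h) (v : TangentSpace (𝓡 n) (j y)))
    exact ⟨q.1, q.2, hq, w, hqw⟩)
  set d := (mdifferentiable_of_mem_maximalAtlas hφ).symm.mfderiv hy with hd
  rw [eq_top_iff]
  intro v _
  obtain ⟨X, ξ, hp, w, hw⟩ := h1 (d v)
  set X' : EuclideanSpace ℝ (Fin n) := d.symm X with hX'
  have hX : d X' = X := d.apply_symm_apply X
  have hv : v = X' + ℓ w := by
    apply d.injective
    refine hw.symm.trans (Eq.trans ?_ (map_add d X' (ℓ w)).symm)
    exact congrArg (fun Y : EuclideanSpace ℝ (Fin n) =>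
      Y + (show EuclideanSpace ℝ (Fin n) from d (ℓ w))) hX.symm
  rw [hv]
  refine Submodule.add_mem_sup ⟨(X', ξ.comp (mfderiv (𝓡 n) (𝓡 n) φ.symm (ℓ y))), ?_, rfl⟩
    ⟨w, rfl⟩
  refine mem_inChart.2 ⟨ξ, ?_, rfl⟩
  have h2 : mfderiv (𝓡 n) (𝓡 n) φ.symm (ℓ y) X' = X := hX
  rw [h2]
  exact hp

end ChartTransversal


/-! ### Stability of the leaf. -/

section Stability

open Set Filter Module

variable {n : ℕ} {M : Type*} [TopologicalSpace M] [ChartedSpace (EuclideanSpace ℝ (Fin n)) M]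

/-- The Dirac structures with a frame close to a given frame of `L` form a neighbourhood of `L`. -/
theorem DiracStructure.mem_nhds_csTopology {L : DiracStructure n M} (s : ℕ)
    {φ : OpenPartialHomeomorph M (EuclideanSpace ℝ (Fin n))}
    (hφ : φ ∈ IsManifold.maximalAtlas (𝓡 n) ∞ M) {V K : Set (EuclideanSpace ℝ (Fin n))}
    {e : Fin n → EuclideanSpace ℝ (Fin n) →
      EuclideanSpace ℝ (Fin n) × (EuclideanSpace ℝ (Fin n) →L[ℝ] ℝ)} {ε : ℝ} (hV : IsOpen V)
    (hVφ : V ⊆ φ.target) (hK : IsCompact K) (hKV : K ⊆ V)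
    (he : IsSmoothFrameOn (inChart L.fiber φ) V e) (hε : 0 < ε) :
    {L' : DiracStructure n M | ∃ V' : Set (EuclideanSpace ℝ (Fin n)),
      IsOpen V' ∧ V' ⊆ V ∧ K ⊆ V' ∧ ∃ e' : Fin n → EuclideanSpace ℝ (Fin n) →
        EuclideanSpace ℝ (Fin n) × (EuclideanSpace ℝ (Fin n) →L[ℝ] ℝ),
        IsSmoothFrameOn (inChart L'.fiber φ) V' e' ∧ ∀ i, ∀ j ≤ s, ∀ x ∈ K,
          ‖iteratedFDeriv ℝ j (e' i) x - iteratedFDeriv ℝ j (e i) x‖ < ε} ∈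
      @nhds _ (DiracStructure.csTopology s) L := by
  let _ := DiracStructure.csTopology (n := n) (M := M) s
  refine IsOpen.mem_nhds (TopologicalSpace.isOpen_generateFrom_of_mem
    ⟨φ, hφ, V, K, e, ε, hV, hVφ, hK, hKV, he.smooth, hε, rfl⟩) ?_
  exact ⟨V, hV, Subset.rfl, hKV, e, he, fun i j _ x _ => by simpa using hε⟩

/-- The bivector on a linear transversal as a function of a frame. -/
def frameBivector {E G Z : Type*} [NormedAddCommGroup E] [NormedSpace ℝ E] [NormedAddCommGroup G]
    [NormedSpace ℝ G] [NormedAddCommGroup Z] [NormedSpace ℝ Z] {m : ℕ} (ℓ : G →L[ℝ] E)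
    (a : E →L[ℝ] G) (p : E →L[ℝ] Z) (e : Fin m → E × (E →L[ℝ] ℝ)) : (G →L[ℝ] ℝ) →L[ℝ] G :=
  (a.comp (ContinuousLinearMap.fst ℝ E (E →L[ℝ] ℝ))).comp
    ((normalizeFrame (transverseMap ℓ p) e).comp (ContinuousLinearMap.inr ℝ Z (G →L[ℝ] ℝ)))

theorem contDiffAt_frameBivector {E G Z : Type*} [NormedAddCommGroup E] [NormedSpace ℝ E]
    [NormedAddCommGroup G] [NormedSpace ℝ G] [NormedAddCommGroup Z] [NormedSpace ℝ Z] {m : ℕ}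
    {ℓ : G →L[ℝ] E} (a : E →L[ℝ] G) {p : E →L[ℝ] Z} {e : Fin m → E × (E →L[ℝ] ℝ)}
    (he : e ∈ regularFrames (transverseMap ℓ p) m) : ContDiffAt ℝ ∞ (frameBivector ℓ a p) e :=
  contDiffAt_const.clm_comp ((contDiffAt_normalizeFrame he).clm_comp contDiffAt_const)

/-- A leaf through a `k`-stable singular point of the transverse Poisson structure is stable. -/
theorem DiracStructure.IsLeaf.isStableLeaf [IsManifold (𝓡 n) ∞ M] {L : DiracStructure n M}
    {S : Set M} (hS : L.IsLeaf S) {m₀ : M} (hm₀ : m₀ ∈ S) {k : ℕ}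
    (hk : L.IsKStableTransverse (2 * k) k m₀) : L.IsStableLeaf (2 * k) S := by
  obtain ⟨r, V, j, π, hT, hst⟩ := hk
  obtain ⟨φ, hφ, ℓ, hℓ, V₁, hV₁, h0V₁, hV₁V, hjℓ⟩ :=
    exists_chart_symm_comp_eq hT.isOpen hT.zero_mem hT.smooth (hT.immersion 0 hT.zero_mem)
  have hjev : ∀ y ∈ V₁, j =ᶠ[𝓝 y] φ.symm ∘ ℓ := fun y hy => by
    filter_upwards [hV₁.mem_nhds hy] with z hz using (hjℓ z hz).2.symm
  have hfin : finrank ℝ (EuclideanSpace ℝ (Fin n)) = n := finrank_euclideanSpace_fin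
  have hD := L.isDirac φ hφ
  obtain ⟨V₀, hV₀, h0V₀, hV₀φ, he⟩ := hD.smooth (ℓ 0) (hjℓ 0 h0V₁).1
  rw [hfin] at he
  obtain ⟨e, he⟩ := he
  obtain ⟨a, p, hs⟩ := exists_isSplitSequence hℓ
  have hback : ∀ y ∈ V₁, ∀ α v, (∃ η, (ℓ v, η) ∈ inChart L.fiber φ (ℓ y) ∧ α = η.comp ℓ) →
      v = π.toFun y α := fun y hy α v h => by
    have h1 := (mem_backwardImage_symm_comp hφ (hjℓ y hy).1 (v, α)).2 h
    rw [← backwardImage_congr (hjev y hy)] at h1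
    exact (hT.induced y (hV₁V hy)).subset h1
  have hreg : (fun i => e i (ℓ 0)) ∈ regularFrames (transverseMap ℓ p) n := by
    refine mem_regularFrames_transverseMap hs hD (hjℓ 0 h0V₁).1
      (map_fst_inChart_sup_range_eq_top hφ (hjℓ 0 h0V₁).1 (hjev 0 h0V₁)
        hT.transverse.sup_eq_top) (fun v η hv hη => ?_) hfin (he.span_eq _ h0V₀)
    have h1 := hback 0 h0V₁ 0 v ⟨η, hv, hη.symm⟩
    rw [h1, map_zero]
  set Vr := V₀ ∩ (fun x i => e i x) ⁻¹' regularFrames (transverseMap ℓ p) n with hVr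
  have hVro : IsOpen Vr := he.isOpen_regular hV₀ _
  have hσ := he.isNormalizedFrameOn hVro inter_subset_left fun x hx => hx.2
  have h0Vr : ℓ 0 ∈ Vr := ⟨h0V₀, hreg⟩
  -- Both bivectors have as graph the backward image of `L`, so the given transverse structure is
  -- computed from the frame `e`.
  have hπeq : ∀ y ∈ V₁, ℓ y ∈ Vr →
      π.toFun y = frameBivector ℓ a p (fun i => e i (ℓ y)) := fun y hy hyr => by
    ext1 α
    exact (hback y hy α _ (transverseBivector_apply_of_mem hs hσ hyr α)).symm
  -- The order of a singularity is positive, so the vanishing jet includes the value.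
  have hzero : ∀ {m : ℕ} {N : Set (EuclideanSpace ℝ (Fin r))} {π' : BivectorField N}
      {x : EuclideanSpace ℝ (Fin r)}, π'.IsSingularityOfOrder m x → π'.toFun x = 0 := by
    rintro m N π' x ⟨hm, -, h, -⟩
    have h1 := DFunLike.congr_fun (h 0 hm) ![]
    simpa using h1
  have hsymm0 : φ.symm (ℓ 0) = m₀ := (hjℓ 0 h0V₁).2.trans hT.map_zero
  set d := finrank ℝ (Fin (finrank ℝ (EuclideanSpace ℝ (Fin n)) -
    finrank ℝ (EuclideanSpace ℝ (Fin r))) → ℝ) with hd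
  refine ⟨d, ?_, fun U hU hSU => ?_⟩
  · have h0 : π.toFun 0 = 0 := hzero (hst V Subset.rfl hT.isOpen hT.zero_mem).2.1
    rw [hπeq 0 h0V₁ h0Vr] at h0
    have h1 := finrank_map_fst_of_transverseBivector_eq_zero hs hσ h0Vr h0
    rw [L.finrank_map_fst_inChart hφ (hjℓ 0 h0V₁).1, hsymm0] at h1
    rw [hd, ← h1]
    exact hS.hasLeafDim hm₀
  · have hgood : V₁ ∩ j ⁻¹' U ∩ ℓ ⁻¹' Vr ∈ 𝓝 (0 : EuclideanSpace ℝ (Fin r)) := by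
      refine IsOpen.mem_nhds (((hT.smooth.continuousOn.mono hV₁V).isOpen_inter_preimage hV₁ hU).inter
        (hVro.preimage ℓ.continuous)) ⟨⟨h0V₁, ?_⟩, h0Vr⟩
      rw [mem_preimage, hT.map_zero]
      exact hSU hm₀
    obtain ⟨ρ, hρ, hball⟩ := Metric.nhds_basis_closedBall.mem_iff.1 hgood
    set N := Metric.ball (0 : EuclideanSpace ℝ (Fin r)) ρ with hN
    set Kb := Metric.closedBall (0 : EuclideanSpace ℝ (Fin r)) ρ with hKb
    have hKbc : IsCompact Kb := isCompact_closedBall _ _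
    have hNK : N ⊆ Kb := Metric.ball_subset_closedBall
    have hNV : N ⊆ V := fun y hy => hV₁V (hball (hNK hy)).1.1
    -- Stability is applied to the restriction to `N`, because the bivectors of nearby Dirac
    -- structures are only available there.
    obtain ⟨-, -, hstab⟩ := hst N hNV Metric.isOpen_ball (Metric.mem_ball_self hρ)
    obtain ⟨W, hW, hWst⟩ := hstab N (Metric.ball_mem_nhds _ hρ)
    obtain ⟨K, -, hKN, ε, hε, hKW⟩ := exists_isCompact_of_mem_nhds_csTopology hW
    obtain ⟨δ, hδ, hδc⟩ := exists_forall_iteratedFDeriv_comp_sub_lt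
      (Ψ := frameBivector ℓ a p) (isOpen_regularFrames (q := transverseMap ℓ p) (r := n))
      (fun z hz => contDiffAt_frameBivector a hz) hKbc (u := fun y i => e i (ℓ y))
      (fun y hy => contDiffAt_pi.2 fun i => ((he.smooth i).contDiffAt
        (hV₀.mem_nhds (hball hy).2.1)).comp y ℓ.contDiff.contDiffAt)
      (fun y hy => (hball hy).2.2) (2 * k) hε
    -- `c` bounds the factors `‖ℓ‖ ^ i` from composition with `ℓ` for all `i ≤ 2 * k`; the base is
    -- at least `1`, so the highest power dominates.
    set c := (1 + ‖ℓ‖) ^ (2 * k) with hc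
    have hcpos : 0 < c := by positivity
    refine ⟨_, DiracStructure.mem_nhds_csTopology (2 * k) hφ hV₀ hV₀φ
      (hKbc.image ℓ.continuous) (image_subset_iff.2 fun y hy => (hball hy).2.1) he
      (show 0 < δ / (2 * c) by positivity), ?_⟩
    rintro L' ⟨V', hV', hV'V₀, hKV', e', he', hclose⟩
    have hD' := L'.isDirac φ hφ
    obtain ⟨hreg', hclose'⟩ := hδc (fun y i => e' i (ℓ y))
      (fun y hy => contDiffAt_pi.2 fun i => ((he'.smooth i).contDiffAt
        (hV'.mem_nhds (hKV' (mem_image_of_mem ℓ hy)))).comp y ℓ.contDiff.contDiffAt)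
      (fun y hy i hi => by
        have hyV' := hKV' (mem_image_of_mem ℓ hy)
        refine (norm_iteratedFDeriv_pi_comp_sub_le ℓ hV' (fun i => (he.smooth i).mono hV'V₀)
          he'.smooth hyV' (δ := δ / (2 * c)) (by positivity)
          fun l => (hclose l i hi _ (mem_image_of_mem ℓ hy)).le).trans_lt ?_
        have h1 : ‖ℓ‖ ^ i ≤ c := (pow_le_pow_left₀ (norm_nonneg _) (by linarith) i).trans
          (pow_le_pow_right₀ (by linarith [norm_nonneg ℓ]) hi)
        calc δ / (2 * c) * ‖ℓ‖ ^ i ≤ δ / (2 * c) * c := by gcongr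
          _ = δ / 2 := by field_simp
          _ < δ := half_lt_self hδ)
    have hσ' := he'.isNormalizedFrameOn (he'.isOpen_regular hV' (transverseMap ℓ p))
      inter_subset_left fun x hx => hx.2
    have hNσ : ∀ y ∈ N, ℓ y ∈ V' ∩ (fun x i => e' i x) ⁻¹' regularFrames (transverseMap ℓ p) n :=
      fun y hy => ⟨hKV' (mem_image_of_mem ℓ (hNK hy)), hreg' y (hNK hy)⟩
    have hsub : V' ∩ (fun x i => e' i x) ⁻¹' regularFrames (transverseMap ℓ p) n ⊆ φ.target :=
      fun x hx => hV₀φ (hV'V₀ hx.1)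
    obtain ⟨x, hxN, hx⟩ := hWst (transverseBivectorField hs hD' hσ' hsub hNσ)
      (hKW _ fun y hy i hi => by
        have h1 : (π.restrict hNV).toFun =ᶠ[𝓝 y]
            frameBivector ℓ a p ∘ fun y i => e i (ℓ y) := by
          filter_upwards [Metric.isOpen_ball.mem_nhds (hKN hy)] with z hz
            using hπeq z (hball (hNK hz)).1.1 (hball (hNK hz)).2
        rw [(h1.iteratedFDeriv ℝ i).eq_of_nhds]
        exact hclose' y (hNK (hKN hy)) i hi)
      (transverseBivectorField_isPoisson hs hD' hσ' hsub hNσ)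
    -- The rank at the new zero is computed with the same `p` as for `L` at `m₀`, hence equals `d`.
    have h2 := finrank_map_fst_of_transverseBivector_eq_zero hs hσ' (hNσ x hxN) (hzero hx)
    have hxV₁ := (hball (hNK hxN)).1
    rw [L'.finrank_map_fst_inChart hφ (hjℓ x hxV₁.1).1] at h2
    obtain ⟨S', hS', hdim, hmem⟩ := DiracStructure.exists_isLeaf_hasLeafDim (L := L') (φ.symm (ℓ x))
    rw [h2] at hdim
    refine ⟨S', hS', hdim, φ.symm (ℓ x), hmem, ?_⟩
    rw [(hjℓ x hxV₁.1).2]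
    exact hxV₁.2

end Stability

end DiracStability

end

theorem proposition4p1 {n : ℕ} {M : Type*} [TopologicalSpace M] [T2Space M]
    [SecondCountableTopology M] [ChartedSpace (EuclideanSpace ℝ (Fin n)) M]
    [IsManifold (𝓡 n) ∞ M]
    (L : DiracStability.DiracStructure n M) (S : Set M)
    (hemb : DiracStability.IsEmbeddedSubmanifold n S)
    (hsing : L.IsSingularLeaf S)
    (m₀ : M) (hm₀ : m₀ ∈ S) (k : ℕ)
    (hk : L.IsKStableTransverse (2 * k) k m₀) :
    L.IsStableLeaf (2 * k) S :=
  hsing.1.isStableLeaf hm₀ hk
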